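/- Let $n\ge 3$ and $l\ge 2$ be integers, and let $G=K_{2n}\circ_n K_{2n}\circ_n\cdots\circ_n K_{2n}$ be the $n$-coalescence of $l$ copies of the complete graph $K_{2n}$: in each of $l$ disjoint copies of $K_{2n}$ a complete subgraph $K_n$ is chosen, and the corresponding vertices of these $l$ subgraphs are identified. For a finite connected simple graph $H$ with distance function $d$, let $e_H(u)=\max_v d(u,v)$ be the eccentricity of the vertex $u$; the eccentricity matrix $\epsilon(H)$ has the entry $d(u,v)$ at $(u,v)$ if $d(u,v)=\min\{e_H(u),e_H(v)\}$, and $0$ otherwise; the eccentricity energy $E_\epsilon(H)$ is the sum of the absolute values of the eigenvalues of $\epsilon(H)$, counted with multiplicity. Then for every edge $e$ of $G$, whether it lies inside the common clique $K_n$, joins the clique to a vertex outside it, or lies outside the clique, $$E_\epsilon(G)<E_\epsilon(G\setminus\{e\}).$$ -/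

import Mathlib

noncomputable section

/-- The vertices of the `k`-coalescence of a family of graphs along marked complete subgraphs:
the `k` vertices of the common clique, and for each graph its vertices outside the marked clique. -/
abbrev CoalVert {ι : Type*} {k : ℕ} {V : ι → Type*} {G : ∀ i, SimpleGraph (V i)}
    (f : ∀ i, (⊤ : SimpleGraph (Fin k)) ↪g G i) : Type _ :=
  Fin k ⊕ (Σ i, {v : V i // v ∉ Set.range (f i)})

open Classical in
/-- The canonical map of the vertices of the `i`-th graph to the coalescence: the vertex `f i a` of
the marked clique goes to the common vertex `a`, the others are kept. -/
def coalIncl {ι : Type*} {k : ℕ} {V : ι → Type*} {G : ∀ i, SimpleGraph (V i)}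
    (f : ∀ i, (⊤ : SimpleGraph (Fin k)) ↪g G i) (i : ι) (v : V i) : CoalVert f :=
  if h : v ∈ Set.range (f i) then Sum.inl h.choose else Sum.inr ⟨i, v, h⟩

/-- The `k`-coalescence of the graphs `G i`: the induced complete subgraphs on `k` vertices given by
the embeddings `f i` are identified, vertex `f i a` with vertex `f j a`. Its edges are the images of
the edges of all the `G i`. -/
def coalescence {ι : Type*} {k : ℕ} {V : ι → Type*} {G : ∀ i, SimpleGraph (V i)}
    (f : ∀ i, (⊤ : SimpleGraph (Fin k)) ↪g G i) : SimpleGraph (CoalVert f) :=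
  ⨆ i, (G i).map (coalIncl f i)

open Classical in
/-- The eccentricity matrix: the entry at `u, v` is the distance of `u` and `v` if that is the
smaller of their eccentricities, and `0` otherwise. -/
def eccMatrix {V : Type*} (G : SimpleGraph V) : Matrix V V ℝ :=
  Matrix.of fun u v =>
    if (G.dist u v : ℕ∞) = min (G.eccent u) (G.eccent v) then (G.dist u v : ℝ) else 0

theorem eccMatrix_isHermitian {V : Type*} (G : SimpleGraph V) : (eccMatrix G).IsHermitian := by
  ext u v
  simp [eccMatrix, SimpleGraph.dist_comm (u := v) (v := u), min_comm (G.eccent v)]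

open Classical in
/-- The eccentricity energy: the sum of the absolute values of the eigenvalues of the eccentricity
matrix, with multiplicity. -/
def eccEnergy {V : Type*} [Fintype V] (G : SimpleGraph V) : ℝ :=
  ∑ i, |(eccMatrix_isHermitian G).eigenvalues i|

end

/-! The common clique consists of universal vertices and all other eccentricities are 2, so the
eccentricity matrix of `G` is explicit: off the diagonal it is 1 where a clique vertex is involved,
0 inside a page (the `n` outer vertices of one copy) and 2 between different pages. It acts as `-1`
on zero-sum vectors of the clique and as `-2n` on page-constant vectors of total sum zero outside
it. Deleting an edge changes few rows, and the two energies are separated by variational bounds,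
without computing a spectrum.

Upper bound for `G`: if `M = A - B` with `A`, `B` positive semidefinite, the energy is at most `tr A
+ tr B`. Taking for `B` the negative part above plus a correction of size `t` on constant clique
vectors gives `2 (n - 1 + t + 2n(l-1))`. Here `t = 1` is always admissible, and `t = 0` is for `l ≥
4`.

Lower bound after deletion: if `0 ≤ P ≤ 1`, the energy is at least `tr M - 2 tr (P M)`. The test
matrix `P` is the projection to the old negative directions that survive, plus rank-one projections
`R` to new directions with very negative Rayleigh quotient. An edge touching the clique yields
strictly more than `2 (n + 2n(l-1))`. An edge outside it yields `2 (n + 1 + 2n(l-1))` minus a small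
loss, which the choice of `t` absorbs. The two bounds are `sum_abs_eigenvalues_book_le` and
`le_sum_abs_eigenvalues_book`. -/

open Matrix

/-! ### Variational bounds for the sum of absolute eigenvalues. -/

section Spectral

variable {V : Type*} [Fintype V] [DecidableEq V] {M : Matrix V V ℝ}

/-- The `i`-th vector of an orthonormal eigenbasis of a real symmetric matrix. -/
noncomputable def eigvec (hM : M.IsHermitian) (i : V) : V → ℝ :=
  fun j => (hM.eigenvectorUnitary : Matrix V V ℝ) j i

theorem conj_eigenvectorUnitary_apply (hM : M.IsHermitian) (P : Matrix V V ℝ) (i : V) :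
    (star (hM.eigenvectorUnitary : Matrix V V ℝ) * P * (hM.eigenvectorUnitary : Matrix V V ℝ)) i i
      = eigvec hM i ⬝ᵥ (P *ᵥ eigvec hM i) := by
  rw [Matrix.mul_assoc, Matrix.mul_apply]
  simp [dotProduct, Matrix.mulVec, Matrix.mul_apply, eigvec, Matrix.star_apply]

theorem eigvec_dotProduct_self (hM : M.IsHermitian) (i : V) :
    eigvec hM i ⬝ᵥ eigvec hM i = 1 := by
  have h := conj_eigenvectorUnitary_apply hM 1 i
  rw [Matrix.mul_one, Unitary.coe_star_mul_self] at h
  simpa using h.symm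

theorem trace_eq_sum_eigvec (hM : M.IsHermitian) (P : Matrix V V ℝ) :
    P.trace = ∑ i, eigvec hM i ⬝ᵥ (P *ᵥ eigvec hM i) := by
  simp_rw [← conj_eigenvectorUnitary_apply hM P]
  change _ = Matrix.trace _
  rw [Matrix.mul_assoc, Matrix.trace_mul_comm, Matrix.mul_assoc,
    Unitary.mul_star_self_of_mem hM.eigenvectorUnitary.2, Matrix.mul_one]

theorem mulVec_eigvec (hM : M.IsHermitian) (i : V) :
    M *ᵥ eigvec hM i = hM.eigenvalues i • eigvec hM i := by
  have h := hM.mulVec_eigenvectorBasis i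
  have e : eigvec hM i = (hM.eigenvectorBasis i).ofLp := by
    ext j; simp [eigvec]
  rw [e]; exact h

/-- Splitting a real symmetric matrix into a difference of positive semidefinite matrices bounds the
sum of the absolute values of its eigenvalues. -/
theorem sum_abs_eigenvalues_le (hM : M.IsHermitian) {A B : Matrix V V ℝ} (hAB : M = A - B)
    (hA : ∀ x, 0 ≤ x ⬝ᵥ (A *ᵥ x)) (hB : ∀ x, 0 ≤ x ⬝ᵥ (B *ᵥ x)) :
    ∑ i, |hM.eigenvalues i| ≤ A.trace + B.trace := by
  rw [trace_eq_sum_eigvec hM A, trace_eq_sum_eigvec hM B, ← Finset.sum_add_distrib]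
  refine Finset.sum_le_sum fun i _ => ?_
  have h : hM.eigenvalues i =
      eigvec hM i ⬝ᵥ (A *ᵥ eigvec hM i) - eigvec hM i ⬝ᵥ (B *ᵥ eigvec hM i) := by
    rw [← dotProduct_sub, ← Matrix.sub_mulVec, ← hAB, mulVec_eigvec, dotProduct_smul,
      eigvec_dotProduct_self]; simp
  rw [h, abs_le]
  constructor <;> linarith [hA (eigvec hM i), hB (eigvec hM i)]

/-- A quadratic form between `0` and the identity bounds from below the sum of the absolute values
of the eigenvalues of a real symmetric matrix. -/
theorem le_sum_abs_eigenvalues (hM : M.IsHermitian) {P : Matrix V V ℝ}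
    (h0 : ∀ x, 0 ≤ x ⬝ᵥ (P *ᵥ x)) (h1 : ∀ x, x ⬝ᵥ (P *ᵥ x) ≤ x ⬝ᵥ x) :
    M.trace - 2 * (P * M).trace ≤ ∑ i, |hM.eigenvalues i| := by
  rw [trace_eq_sum_eigvec hM M, trace_eq_sum_eigvec hM (P * M), Finset.mul_sum,
    ← Finset.sum_sub_distrib]
  refine Finset.sum_le_sum fun i _ => ?_
  rw [← Matrix.mulVec_mulVec, mulVec_eigvec, Matrix.mulVec_smul, dotProduct_smul, dotProduct_smul,
    eigvec_dotProduct_self]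
  have a := h0 (eigvec hM i)
  have b := h1 (eigvec hM i)
  rw [eigvec_dotProduct_self] at b
  set p := eigvec hM i ⬝ᵥ (P *ᵥ eigvec hM i)
  simp only [smul_eq_mul]
  -- Since `0 ≤ p ≤ 1`, the factor `1 - 2p` lies in `[-1, 1]`, so `(1 - 2p) λ ≤ |λ|` for either sign
  -- of `λ`.
  rcases le_total 0 (hM.eigenvalues i) with h | h
  · rw [abs_of_nonneg h]; nlinarith
  · rw [abs_of_nonpos h]; nlinarith

end Spectral

/-! ### Eccentricity matrices of graphs with a universal vertex. -/

section Graph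

variable {V : Type*} {G : SimpleGraph V}

/-- A vertex adjacent to all others. -/
def IsUniversal (G : SimpleGraph V) (c : V) : Prop := ∀ v, v ≠ c → G.Adj c v

theorem IsUniversal.connected {c : V} (hc : IsUniversal G c) : G.Connected := by
  have : Nonempty V := ⟨c⟩
  have h : ∀ v, G.Reachable c v := fun v => by
    by_cases e : v = c
    · rw [e]
    · exact (hc v e).reachable
  exact SimpleGraph.Connected.mk fun u v => (h u).symm.trans (h v)

theorem IsUniversal.dist_eq_two {c u v : V} (hc : IsUniversal G c) (huv : u ≠ v)
    (h : ¬ G.Adj u v) : G.dist u v = 2 := by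
  have hu : c ≠ u := by rintro rfl; exact h (hc v huv.symm)
  have hv : c ≠ v := by rintro rfl; exact h (hc u huv).symm
  have hle : G.dist u v ≤ 2 :=
    SimpleGraph.dist_le
      (SimpleGraph.Walk.cons (hc u hu.symm).symm (SimpleGraph.Walk.cons (hc v hv.symm) .nil))
  have h0 : G.dist u v ≠ 0 := (hc.connected.dist_eq_zero_iff).not.mpr huv
  have h1 : G.dist u v ≠ 1 := SimpleGraph.dist_eq_one_iff_adj.not.mpr h
  omega

theorem IsUniversal.coe_dist {c : V} (hc : IsUniversal G c) (u v : V) :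
    (G.dist u v : ℕ∞) = G.edist u v :=
  ENat.natCast_toNat (SimpleGraph.edist_ne_top_iff_reachable.mpr (hc.connected u v))

theorem IsUniversal.eccent_eq_one [Nontrivial V] {u : V} (hu : IsUniversal G u) :
    G.eccent u = 1 := by
  apply le_antisymm
  · refine iSup_le fun v => ?_
    by_cases e : v = u
    · simp [e]
    · rw [SimpleGraph.edist_eq_one_iff_adj.mpr (hu v e)]
  · obtain ⟨v, hv⟩ := exists_ne u
    rw [← SimpleGraph.edist_eq_one_iff_adj.mpr (hu v hv)]
    exact SimpleGraph.edist_le_eccent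

theorem IsUniversal.eccent_eq_two {c u : V} (hc : IsUniversal G c) (hu : ¬ IsUniversal G u) :
    G.eccent u = 2 := by
  apply le_antisymm
  · refine iSup_le fun v => ?_
    rw [← hc.coe_dist]
    by_cases e : u = v
    · simp [e]
    · by_cases h : G.Adj u v
      · rw [SimpleGraph.dist_eq_one_iff_adj.mpr h]; norm_num
      · rw [hc.dist_eq_two e h]; norm_num
  · unfold IsUniversal at hu
    push Not at hu
    obtain ⟨v, hv, h⟩ := hu
    have := hc.dist_eq_two hv.symm h
    calc (2 : ℕ∞) = G.dist u v := by rw [this]; norm_num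
      _ ≤ _ := by rw [hc.coe_dist]; exact SimpleGraph.edist_le_eccent

theorem eccMatrix_self (u : V) : eccMatrix G u u = 0 := by
  simp [eccMatrix]

theorem eccMatrix_of_universal [Nontrivial V] {u v : V} (hu : IsUniversal G u) (h : u ≠ v) :
    eccMatrix G u v = 1 := by
  have hd : G.dist u v = 1 := SimpleGraph.dist_eq_one_iff_adj.mpr (hu v h.symm)
  have he : (1 : ℕ∞) ≤ G.eccent v := by
    by_cases hv : IsUniversal G v
    · rw [hv.eccent_eq_one]
    · rw [hu.eccent_eq_two hv]; norm_num
  simp [eccMatrix, hd, hu.eccent_eq_one, he]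

theorem eccMatrix_comm (u v : V) : eccMatrix G u v = eccMatrix G v u := by
  simpa using ((eccMatrix_isHermitian G).apply u v).symm

/-- Both eccentricities are 2, so distance 1 falls short of their minimum. This is why a vertex that
loses universality also loses its entries with non-universal neighbours. -/
theorem eccMatrix_of_adj {c u v : V} (hc : IsUniversal G c) (hu : ¬ IsUniversal G u)
    (hv : ¬ IsUniversal G v) (h : G.Adj u v) : eccMatrix G u v = 0 := by
  have hd : G.dist u v = 1 := SimpleGraph.dist_eq_one_iff_adj.mpr h
  simp [eccMatrix, hd, hc.eccent_eq_two hu, hc.eccent_eq_two hv]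

theorem eccMatrix_of_not_adj {c u v : V} (hc : IsUniversal G c) (huv : u ≠ v)
    (h : ¬ G.Adj u v) : eccMatrix G u v = 2 := by
  have hu : ¬ IsUniversal G u := fun H => h (H v huv.symm)
  have hv : ¬ IsUniversal G v := fun H => h (H u huv).symm
  simp [eccMatrix, hc.dist_eq_two huv h, hc.eccent_eq_two hu, hc.eccent_eq_two hv]

end Graph

/-! ### Quadratic forms and traces of rank-one and diagonal matrices. -/

section QuadraticForm

variable {V : Type*} [Fintype V]

theorem dotProduct_vecMulVec_mulVec (a b x : V → ℝ) :
    x ⬝ᵥ (vecMulVec a b *ᵥ x) = (a ⬝ᵥ x) * (b ⬝ᵥ x) := by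
  rw [Matrix.vecMulVec_mulVec]
  simp [dotProduct_comm x a, mul_comm]

theorem trace_vecMulVec_mul (a b : V → ℝ) (M : Matrix V V ℝ) :
    (vecMulVec a b * M).trace = b ⬝ᵥ (M *ᵥ a) := by
  rw [Matrix.vecMulVec_mul, Matrix.trace_vecMulVec, dotProduct_comm, Matrix.dotProduct_mulVec]

theorem dotProduct_diagonal_mulVec [DecidableEq V] (d x : V → ℝ) :
    x ⬝ᵥ (diagonal d *ᵥ x) = ∑ v, d v * x v ^ 2 := by
  simp only [dotProduct, Matrix.mulVec_diagonal]
  exact Finset.sum_congr rfl fun v _ => by ring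

theorem trace_diagonal_mul_eq_zero [DecidableEq V] (d : V → ℝ) {M : Matrix V V ℝ}
    (hM : ∀ v, M v v = 0) : (diagonal d * M).trace = 0 := by
  simp [Matrix.trace, Matrix.diagonal_mul, hM]

end QuadraticForm

/-! ### Cliques sharing a clique, and the matrix of this graph. -/

section Book

variable {C ι : Type*} {W : ι → Type*}

/-- The graph formed by cliques that share the clique `C`: two distinct vertices are adjacent unless
they lie in different sets `W i`. -/
def cliqueBook (C : Type*) {ι : Type*} (W : ι → Type*) : SimpleGraph (C ⊕ Σ i, W i) where
  Adj u v := u ≠ v ∧ ∀ p q, u = Sum.inr p → v = Sum.inr q → p.1 = q.1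
  symm := ⟨fun _ _ h => ⟨h.1.symm, fun p q hp hq => (h.2 q p hq hp).symm⟩⟩
  loopless := ⟨fun _ h => h.1 rfl⟩

@[simp] theorem cliqueBook_adj_inl_inl {a b : C} :
    (cliqueBook C W).Adj (Sum.inl a) (Sum.inl b) ↔ a ≠ b := by
  simp [cliqueBook]

@[simp] theorem cliqueBook_adj_inl_inr {a : C} {p : Σ i, W i} :
    (cliqueBook C W).Adj (Sum.inl a) (Sum.inr p) := by
  simp [cliqueBook]

@[simp] theorem cliqueBook_adj_inr_inl {a : C} {p : Σ i, W i} :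
    (cliqueBook C W).Adj (Sum.inr p) (Sum.inl a) := by
  simp [cliqueBook]

@[simp] theorem cliqueBook_adj_inr_inr {p q : Σ i, W i} :
    (cliqueBook C W).Adj (Sum.inr p) (Sum.inr q) ↔ p ≠ q ∧ p.1 = q.1 := by
  simp [cliqueBook]

variable [DecidableEq C] [DecidableEq ι] [∀ i, DecidableEq (W i)]

/-- The indicator vector of a set of vertices of the common clique. -/
def cliqueVec (W : ι → Type*) (T : Finset C) : C ⊕ (Σ i, W i) → ℝ :=
  Sum.elim (fun c => if c ∈ T then 1 else 0) 0

/-- The indicator vector of the vertices outside the common clique. -/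
def outerVec (C : Type*) {ι : Type*} (W : ι → Type*) : C ⊕ (Σ i, W i) → ℝ := Sum.elim 0 1

/-- The indicator vector of `W i`. -/
def pageVec (C : Type*) (W : ι → Type*) (i : ι) : C ⊕ (Σ i, W i) → ℝ :=
  Sum.elim 0 (fun p => if p.1 = i then 1 else 0)

variable [Fintype C] [Fintype ι]

/-- The eccentricity matrix of `cliqueBook C W`. -/
def bookMatrix (C : Type*) {ι : Type*} (W : ι → Type*) [DecidableEq C] [DecidableEq ι]
    [∀ i, DecidableEq (W i)] [Fintype C] [Fintype ι] :
    Matrix (C ⊕ Σ i, W i) (C ⊕ Σ i, W i) ℝ :=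
  vecMulVec (cliqueVec W Finset.univ) (cliqueVec W Finset.univ)
    - diagonal (cliqueVec W Finset.univ)
    + vecMulVec (cliqueVec W Finset.univ) (outerVec C W)
    + vecMulVec (outerVec C W) (cliqueVec W Finset.univ)
    + (2 : ℝ) • vecMulVec (outerVec C W) (outerVec C W)
    - (2 : ℝ) • ∑ i, vecMulVec (pageVec C W i) (pageVec C W i)

@[simp] theorem bookMatrix_inl_inl (a b : C) :
    bookMatrix C W (Sum.inl a) (Sum.inl b) = if a = b then 0 else 1 := by
  by_cases h : a = b <;>
    simp [bookMatrix, cliqueVec, outerVec, pageVec, vecMulVec_apply, Matrix.sum_apply, h]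

@[simp] theorem bookMatrix_inl_inr (a : C) (q : Σ i, W i) :
    bookMatrix C W (Sum.inl a) (Sum.inr q) = 1 := by
  simp [bookMatrix, cliqueVec, outerVec, pageVec, vecMulVec_apply, Matrix.sum_apply]

@[simp] theorem bookMatrix_inr_inl (a : C) (q : Σ i, W i) :
    bookMatrix C W (Sum.inr q) (Sum.inl a) = 1 := by
  simp [bookMatrix, cliqueVec, outerVec, pageVec, vecMulVec_apply, Matrix.sum_apply]

@[simp] theorem bookMatrix_inr_inr (p q : Σ i, W i) :
    bookMatrix C W (Sum.inr p) (Sum.inr q) = if p.1 = q.1 then 0 else 2 := by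
  by_cases e : p = q
  · subst e
    simp [bookMatrix, cliqueVec, outerVec, pageVec, vecMulVec_apply, Matrix.sum_apply]
  · by_cases h : p.1 = q.1
    · simp [bookMatrix, cliqueVec, outerVec, pageVec, vecMulVec_apply, Matrix.sum_apply, h, e]
    · simp [bookMatrix, cliqueVec, outerVec, pageVec, vecMulVec_apply, Matrix.sum_apply, h, e]

variable [∀ i, Fintype (W i)]

omit [DecidableEq ι] [(i : ι) → DecidableEq (W i)] in
theorem cliqueVec_dotProduct (T : Finset C) (x : C ⊕ (Σ i, W i) → ℝ) :
    cliqueVec W T ⬝ᵥ x = ∑ c ∈ T, x (Sum.inl c) := by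
  simp [dotProduct, cliqueVec]

omit [DecidableEq C] [DecidableEq ι] [(i : ι) → DecidableEq (W i)] in
theorem outerVec_dotProduct (x : C ⊕ (Σ i, W i) → ℝ) :
    outerVec C W ⬝ᵥ x = ∑ i, ∑ w, x (Sum.inr ⟨i, w⟩) := by
  simp [dotProduct, outerVec, Fintype.sum_sigma]

omit [DecidableEq C] [(i : ι) → DecidableEq (W i)] in
theorem pageVec_dotProduct (i : ι) (x : C ⊕ (Σ i, W i) → ℝ) :
    pageVec C W i ⬝ᵥ x = ∑ w, x (Sum.inr ⟨i, w⟩) := by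
  simp only [dotProduct, pageVec, Fintype.sum_sum_type, Fintype.sum_sigma, Sum.elim_inl,
    Sum.elim_inr, Pi.zero_apply, zero_mul, Finset.sum_const_zero, zero_add, ite_mul, one_mul]
  rw [Finset.sum_eq_single i] <;> simp +contextual

theorem cliqueVec_diagonal_form (T : Finset C) (x : C ⊕ (Σ i, W i) → ℝ) :
    x ⬝ᵥ (diagonal (cliqueVec W T) *ᵥ x) = ∑ c ∈ T, x (Sum.inl c) ^ 2 := by
  simp [dotProduct_diagonal_mulVec, cliqueVec]

omit [DecidableEq C] [DecidableEq ι] [(i : ι) → DecidableEq (W i)] in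
theorem dotProduct_self_book (x : C ⊕ (Σ i, W i) → ℝ) :
    x ⬝ᵥ x = ∑ c, x (Sum.inl c) ^ 2 + ∑ i, ∑ w, x (Sum.inr ⟨i, w⟩) ^ 2 := by
  simp [dotProduct, Fintype.sum_sigma, sq]

theorem bookMatrix_form (x : C ⊕ (Σ i, W i) → ℝ) :
    x ⬝ᵥ (bookMatrix C W *ᵥ x) = (∑ c, x (Sum.inl c)) ^ 2 - ∑ c, x (Sum.inl c) ^ 2
      + 2 * (∑ c, x (Sum.inl c)) * (∑ i, ∑ w, x (Sum.inr ⟨i, w⟩))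
      + 2 * (∑ i, ∑ w, x (Sum.inr ⟨i, w⟩)) ^ 2 - 2 * ∑ i, (∑ w, x (Sum.inr ⟨i, w⟩)) ^ 2 := by
  simp only [bookMatrix, Matrix.sub_mulVec, Matrix.add_mulVec, dotProduct_sub, dotProduct_add,
    Matrix.smul_mulVec, dotProduct_smul, Matrix.sum_mulVec, dotProduct_sum,
    dotProduct_vecMulVec_mulVec, cliqueVec_diagonal_form, cliqueVec_dotProduct,
    outerVec_dotProduct, pageVec_dotProduct, smul_eq_mul, ← sq]
  ring

/-! ### Test matrices: the lower and the upper energy bound. -/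

/-- The projection to the vectors that have sum zero and are supported by `T`, or are constant on each
`W i` and supported outside the common clique. -/
noncomputable def zeroSumProj (W : ι → Type*) [∀ i, DecidableEq (W i)] (n l : ℝ) (T : Finset C) :
    Matrix (C ⊕ Σ i, W i) (C ⊕ Σ i, W i) ℝ :=
  diagonal (cliqueVec W T) - (1 / (T.card : ℝ)) • vecMulVec (cliqueVec W T) (cliqueVec W T)
    + (1 / n) • ∑ i, vecMulVec (pageVec C W i) (pageVec C W i)
    - (1 / (n * l)) • vecMulVec (outerVec C W) (outerVec C W)

theorem zeroSumProj_form (n l : ℝ) (T : Finset C) (x : C ⊕ (Σ i, W i) → ℝ) :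
    x ⬝ᵥ (zeroSumProj W n l T *ᵥ x) = ∑ c ∈ T, x (Sum.inl c) ^ 2
      - (∑ c ∈ T, x (Sum.inl c)) ^ 2 / T.card + (∑ i, (∑ w, x (Sum.inr ⟨i, w⟩)) ^ 2) / n
      - (∑ i, ∑ w, x (Sum.inr ⟨i, w⟩)) ^ 2 / (n * l) := by
  simp only [zeroSumProj, Matrix.sub_mulVec, Matrix.add_mulVec, dotProduct_sub, dotProduct_add,
    Matrix.smul_mulVec, dotProduct_smul, Matrix.sum_mulVec, dotProduct_sum,
    dotProduct_vecMulVec_mulVec, cliqueVec_diagonal_form, cliqueVec_dotProduct,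
    outerVec_dotProduct, pageVec_dotProduct, smul_eq_mul, ← sq]
  ring

theorem zeroSumProj_form_nonneg {n l : ℕ} (hn : 0 < n) (hl : 0 < l) (hι : Fintype.card ι = l)
    {T : Finset C} (hT : T.Nonempty) (x : C ⊕ (Σ i, W i) → ℝ) :
    0 ≤ x ⬝ᵥ (zeroSumProj W n l T *ᵥ x) := by
  rw [zeroSumProj_form]
  have hn' : (0 : ℝ) < n := by exact_mod_cast hn
  have hl' : (0 : ℝ) < l := by exact_mod_cast hl
  have hT' : (0 : ℝ) < T.card := by exact_mod_cast hT.card_pos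
  have h1 : (∑ c ∈ T, x (Sum.inl c)) ^ 2 / T.card ≤ ∑ c ∈ T, x (Sum.inl c) ^ 2 := by
    rw [div_le_iff₀ hT', mul_comm]
    exact sq_sum_le_card_mul_sum_sq
  have h2 : (∑ i, ∑ w, x (Sum.inr ⟨i, w⟩)) ^ 2 / (n * l)
      ≤ (∑ i, (∑ w, x (Sum.inr ⟨i, w⟩)) ^ 2) / n := by
    rw [div_le_div_iff₀ (by positivity) hn']
    have := sq_sum_le_card_mul_sum_sq (s := Finset.univ)
      (f := fun i => ∑ w, x (Sum.inr (⟨i, w⟩ : Σ i, W i)))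
    rw [Finset.card_univ, hι] at this
    nlinarith
  linarith

/-- The diagonal part of the projection contributes nothing because `M` has zero diagonal; only
quadratic forms at indicator vectors remain to be evaluated. -/
theorem trace_zeroSumProj_mul (n l : ℝ) (T : Finset C)
    {M : Matrix (C ⊕ Σ i, W i) (C ⊕ Σ i, W i) ℝ} (hM : ∀ v, M v v = 0) :
    (zeroSumProj W n l T * M).trace =
      - (cliqueVec W T ⬝ᵥ (M *ᵥ cliqueVec W T)) / T.card
      + (∑ i, pageVec C W i ⬝ᵥ (M *ᵥ pageVec C W i)) / n
      - (outerVec C W ⬝ᵥ (M *ᵥ outerVec C W)) / (n * l) := by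
  simp only [zeroSumProj, Matrix.sub_mul, Matrix.add_mul, Matrix.smul_mul, Matrix.trace_sub,
    Matrix.trace_add, Matrix.trace_smul, Finset.sum_mul, Matrix.trace_sum, trace_vecMulVec_mul,
    trace_diagonal_mul_eq_zero _ hM, smul_eq_mul]
  ring

/-- Lower bound for the energy from the test matrix `zeroSumProj W n l T + R`. -/
theorem le_sum_abs_eigenvalues_book {n l : ℕ} (hn : 0 < n) (hl : 0 < l)
    (hι : Fintype.card ι = l) {T : Finset C} (hT : T.Nonempty)
    {M R : Matrix (C ⊕ Σ i, W i) (C ⊕ Σ i, W i) ℝ} (hM : M.IsHermitian) (hd : ∀ v, M v v = 0)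
    (hR : ∀ x, 0 ≤ x ⬝ᵥ (R *ᵥ x))
    (hR' : ∀ x, x ⬝ᵥ (R *ᵥ x) ≤ ∑ c ∈ Tᶜ, x (Sum.inl c) ^ 2
      + (∑ c ∈ T, x (Sum.inl c)) ^ 2 / T.card
      + ∑ i, (∑ w, x (Sum.inr ⟨i, w⟩) ^ 2 - (∑ w, x (Sum.inr ⟨i, w⟩)) ^ 2 / n)
      + (∑ i, ∑ w, x (Sum.inr ⟨i, w⟩)) ^ 2 / (n * l)) :
    2 * (cliqueVec W T ⬝ᵥ (M *ᵥ cliqueVec W T) / T.card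
      - (∑ i, pageVec C W i ⬝ᵥ (M *ᵥ pageVec C W i)) / n
      + outerVec C W ⬝ᵥ (M *ᵥ outerVec C W) / (n * l) - (R * M).trace)
      ≤ ∑ i, |hM.eigenvalues i| := by
  refine le_trans (le_of_eq ?_)
    (le_sum_abs_eigenvalues hM (P := zeroSumProj W n l T + R) (fun x => ?_) (fun x => ?_))
  · rw [Matrix.add_mul, Matrix.trace_add, trace_zeroSumProj_mul _ _ _ hd]
    have : M.trace = 0 := by simp [Matrix.trace, hd]
    rw [this]; ring
  · rw [Matrix.add_mulVec, dotProduct_add]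
    exact add_nonneg (zeroSumProj_form_nonneg hn hl hι hT x) (hR x)
  -- The bound `hR'` is the form of the identity minus `zeroSumProj`: the clique outside `T`, the
  -- mean on `T`, the deviations within pages, and the overall outer mean.
  · rw [Matrix.add_mulVec, dotProduct_add, zeroSumProj_form, dotProduct_self_book,
      ← Finset.sum_add_sum_compl T]
    have := hR' x
    rw [Finset.sum_sub_distrib, ← Finset.sum_div] at this
    linarith

/-- Upper bound for the energy of `cliqueBook C W`. -/
theorem sum_abs_eigenvalues_book_le {n l : ℕ} {t : ℝ} (hn : 0 < n) (hl : 2 ≤ l) (ht : 0 ≤ t)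
    (htl : (l : ℝ) * n ≤ 2 * (n - 1 + t) * (l - 1)) (ht' : 0 ≤ n - 1 + t)
    (hC : Fintype.card C = n) (hι : Fintype.card ι = l) (hW : ∀ i, Fintype.card (W i) = n)
    (hM : (bookMatrix C W).IsHermitian) :
    ∑ i, |hM.eigenvalues i| ≤ 2 * (n - 1 + t + 2 * n * (l - 1)) := by
  have hn' : (0 : ℝ) < n := by exact_mod_cast hn
  have hl' : (2 : ℝ) ≤ l := by exact_mod_cast hl
  -- `B` is 1 on zero-sum clique vectors, `2n` on page-constant vectors of total sum zero, and `t`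
  -- on constant clique vectors. The last makes `bookMatrix C W + B` nonnegative on the plane of
  -- vectors constant on the clique and constant outside it.
  set B : Matrix (C ⊕ Σ i, W i) (C ⊕ Σ i, W i) ℝ :=
    diagonal (cliqueVec W Finset.univ)
      - ((1 - t) / n) • vecMulVec (cliqueVec W Finset.univ) (cliqueVec W Finset.univ)
      + (2 : ℝ) • ∑ i, vecMulVec (pageVec C W i) (pageVec C W i)
      - (2 / (l : ℝ)) • vecMulVec (outerVec C W) (outerVec C W) with hB
  have hBf (x : C ⊕ (Σ i, W i) → ℝ) : x ⬝ᵥ (B *ᵥ x) = ∑ c, x (Sum.inl c) ^ 2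
      - (1 - t) / n * (∑ c, x (Sum.inl c)) ^ 2 + 2 * ∑ i, (∑ w, x (Sum.inr ⟨i, w⟩)) ^ 2
      - 2 / l * (∑ i, ∑ w, x (Sum.inr ⟨i, w⟩)) ^ 2 := by
    simp only [hB, Matrix.sub_mulVec, Matrix.add_mulVec, dotProduct_sub, dotProduct_add,
      Matrix.smul_mulVec, dotProduct_smul, Matrix.sum_mulVec, dotProduct_sum,
      dotProduct_vecMulVec_mulVec, cliqueVec_diagonal_form, cliqueVec_dotProduct,
      outerVec_dotProduct, pageVec_dotProduct, smul_eq_mul, ← sq]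
  have hBt : B.trace = n - 1 + t + 2 * n * (l - 1) := by
    simp only [hB, Matrix.trace_sub, Matrix.trace_add, Matrix.trace_smul, Matrix.trace_sum,
      Matrix.trace_vecMulVec, cliqueVec_dotProduct, outerVec_dotProduct, pageVec_dotProduct]
    simp [cliqueVec, outerVec, pageVec, Matrix.trace_diagonal, hC, hι, hW]
    field_simp
    ring
  have hMt : (bookMatrix C W).trace = 0 := by
    simp [Matrix.trace]
  have := sum_abs_eigenvalues_le hM (A := bookMatrix C W + B) (B := B) (by abel) (fun x => ?_)
    (fun x => ?_)
  · rw [Matrix.trace_add, hMt, hBt] at this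
    linarith
  · rw [Matrix.add_mulVec, dotProduct_add, bookMatrix_form, hBf]
    set X := ∑ c, x (Sum.inl c)
    set Z := ∑ i, ∑ w, x (Sum.inr ⟨i, w⟩)
    -- A binary form in the clique sum and the outer sum; `htl` says that its determinant is
    -- nonnegative, and the square is completed below.
    have key : 0 ≤ (n - 1 + t) / n * X ^ 2 + 2 * X * Z + 2 * (l - 1) / l * Z ^ 2 := by
      rcases ht'.eq_or_lt with h0 | h0
      · rw [← h0] at htl; nlinarith
      have e : (n - 1 + t) / n * X ^ 2 + 2 * X * Z + 2 * (l - 1) / l * Z ^ 2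
          = (((n - 1 + t) * X + n * Z) ^ 2 * l
            + (2 * (n - 1 + t) * (l - 1) - l * n) * n * Z ^ 2) / (n * l * (n - 1 + t)) := by
        field_simp
        ring
      rw [e]
      have : 0 ≤ 2 * (n - 1 + t) * (l - 1) - l * n := by linarith
      positivity
    have e : (n - 1 + t) / n * X ^ 2 = X ^ 2 - (1 - t) / n * X ^ 2 := by field_simp; ring
    have e' : 2 * (l - 1) / l * Z ^ 2 = 2 * Z ^ 2 - 2 / l * Z ^ 2 := by field_simp
    rw [e, e'] at key
    linarith
  · rw [hBf]
    have h1 := sq_sum_le_card_mul_sum_sq (s := Finset.univ)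
      (f := fun c => x (Sum.inl c))
    have h2 := sq_sum_le_card_mul_sum_sq (s := Finset.univ)
      (f := fun i => ∑ w, x (Sum.inr (⟨i, w⟩ : Σ i, W i)))
    rw [Finset.card_univ, hι] at h2
    rw [Finset.card_univ, hC] at h1
    set X := ∑ c, x (Sum.inl c)
    set Z := ∑ i, ∑ w, x (Sum.inr ⟨i, w⟩)
    have h1' : X ^ 2 / n ≤ ∑ c, x (Sum.inl c) ^ 2 := by
      rw [div_le_iff₀ hn']; linarith
    have h2' : Z ^ 2 / l ≤ ∑ i, (∑ w, x (Sum.inr ⟨i, w⟩)) ^ 2 := by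
      rw [div_le_iff₀ (by linarith)]; linarith
    have e : (1 - t) / n * X ^ 2 = X ^ 2 / n - t * (X ^ 2 / n) := by ring
    have e' : 2 / l * Z ^ 2 = 2 * (Z ^ 2 / l) := by ring
    have : 0 ≤ t * (X ^ 2 / n) := by positivity
    rw [e, e']
    linarith

end Book

/-! ### Scalar Cauchy–Schwarz inequalities. -/

/-- Used to check `R ≤ 1`: when a test vector is a sum of orthogonal pieces with squared norms `p`
and `q`, its normalised square splits into those of the pieces. -/
theorem add_sq_div_add_le {a b p q : ℝ} (hp : 0 < p) (hq : 0 < q) :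
    (a + b) ^ 2 / (p + q) ≤ a ^ 2 / p + b ^ 2 / q := by
  rw [div_add_div _ _ hp.ne' hq.ne', div_le_div_iff₀ (by positivity) (by positivity)]
  have : 0 ≤ (a * q - b * p) ^ 2 * (1 : ℝ) := by positivity
  nlinarith [this]

theorem sq_sum_div_card_le {α : Type*} (s : Finset α) (x : α → ℝ) :
    (∑ a ∈ s, x a) ^ 2 / s.card ≤ ∑ a ∈ s, x a ^ 2 := by
  rcases s.eq_empty_or_nonempty with rfl | h
  · simp
  · have : (0 : ℝ) < s.card := by exact_mod_cast h.card_pos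
    rw [div_le_iff₀ this, mul_comm]
    exact sq_sum_le_card_mul_sum_sq

/-- The deviation of one value from the mean bounds the total squared deviation. -/
theorem sq_sub_mean_le {α : Type*} [Fintype α] [DecidableEq α] {n : ℕ} (hn : 2 ≤ n)
    (hα : Fintype.card α = n) (x : α → ℝ) (v : α) :
    (x v - (∑ a, x a) / n) ^ 2 / ((n - 1) / n) ≤ ∑ a, x a ^ 2 - (∑ a, x a) ^ 2 / n := by
  have hn' : (2 : ℝ) ≤ n := by exact_mod_cast hn
  have hn1 : (n : ℝ) - 1 ≠ 0 := by linarith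
  have h := sq_sum_div_card_le ({v}ᶜ : Finset α) x
  rw [Finset.card_compl, hα, Finset.card_singleton, Nat.cast_sub (by omega)] at h
  have e1 := Finset.sum_add_sum_compl {v} x
  have e2 := Finset.sum_add_sum_compl {v} fun a => x a ^ 2
  rw [Finset.sum_singleton] at e1 e2
  rw [← e2, ← e1]
  set r := ∑ a ∈ {v}ᶜ, x a
  have e : (x v - (x v + r) / n) ^ 2 / ((n - 1) / n)
      = x v ^ 2 + r ^ 2 / (n - 1) - (x v + r) ^ 2 / n := by
    field_simp
    ring
  rw [e]
  push_cast at h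
  linarith

/-- The difference of two unit vectors has squared norm 2 and is orthogonal to the constants, so its
component is part of the deviation from the mean. -/
theorem sq_sub_div_two_le {α : Type*} [Fintype α] [DecidableEq α] {n : ℕ} (hn : 3 ≤ n)
    (hα : Fintype.card α = n) (x : α → ℝ) {u v : α} (huv : u ≠ v) :
    (x u - x v) ^ 2 / 2 ≤ ∑ a, x a ^ 2 - (∑ a, x a) ^ 2 / n := by
  have hn' : (3 : ℝ) ≤ n := by exact_mod_cast hn
  have h := sq_sum_div_card_le ({u, v}ᶜ : Finset α) x
  rw [Finset.card_compl, hα, Finset.card_pair huv, Nat.cast_sub (by omega)] at h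
  have e1 := Finset.sum_add_sum_compl {u, v} x
  have e2 := Finset.sum_add_sum_compl {u, v} fun a => x a ^ 2
  rw [Finset.sum_pair huv] at e1 e2
  rw [← e2, ← e1]
  set r := ∑ a ∈ {u, v}ᶜ, x a
  have t := add_sq_div_add_le (a := x u + x v) (b := r) (p := 2) (q := n - 2) (by norm_num)
    (by linarith)
  rw [add_sub_cancel] at t
  push_cast at h
  have e : (x u - x v) ^ 2 / 2 + (x u + x v) ^ 2 / 2 = x u ^ 2 + x v ^ 2 := by ring
  linarith

/-! ### The eccentricity matrix after deletion of an edge. -/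

section Book

variable {C ι : Type*} {W : ι → Type*} [DecidableEq C] [DecidableEq ι] [∀ i, DecidableEq (W i)]
  [Fintype C] [Fintype ι]

/-- The change of the eccentricity matrix when an edge of the common clique is deleted. -/
def cliqueEdgeChange (W : ι → Type*) [∀ i, DecidableEq (W i)] (a b : C) :
    Matrix (C ⊕ Σ i, W i) (C ⊕ Σ i, W i) ℝ :=
  vecMulVec (Pi.single (Sum.inl a) 1) (Pi.single (Sum.inl b) 1)
    + vecMulVec (Pi.single (Sum.inl b) 1) (Pi.single (Sum.inl a) 1)
    - vecMulVec (cliqueVec W {a, b}) (outerVec C W)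
    - vecMulVec (outerVec C W) (cliqueVec W {a, b})

/-- The change of the eccentricity matrix when an edge between the common clique and another vertex
is deleted. -/
def mixedEdgeChange (c : C) (v : Σ i, W i) :
    Matrix (C ⊕ Σ i, W i) (C ⊕ Σ i, W i) ℝ :=
  (2 : ℝ) • vecMulVec (Pi.single (Sum.inl c) 1) (Pi.single (Sum.inr v) 1)
    + (2 : ℝ) • vecMulVec (Pi.single (Sum.inr v) 1) (Pi.single (Sum.inl c) 1)
    - vecMulVec (cliqueVec W {c}) (outerVec C W)
    - vecMulVec (outerVec C W) (cliqueVec W {c})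

/-- The change of the eccentricity matrix when an edge outside the common clique is deleted. -/
def outerEdgeChange (C : Type*) [DecidableEq C] (u v : Σ i, W i) :
    Matrix (C ⊕ Σ i, W i) (C ⊕ Σ i, W i) ℝ :=
  (2 : ℝ) • vecMulVec (Pi.single (Sum.inr u) 1) (Pi.single (Sum.inr v) 1)
    + (2 : ℝ) • vecMulVec (Pi.single (Sum.inr v) 1) (Pi.single (Sum.inr u) 1)

omit [DecidableEq C] [DecidableEq ι] [(i : ι) → DecidableEq (W i)] [Fintype C] [Fintype ι] in
theorem isUniversal_cliqueBook (c : C) : IsUniversal (cliqueBook C W) (Sum.inl c) := by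
  rintro (d | q) h
  · simpa [eq_comm] using h
  · simp

omit [DecidableEq C] [DecidableEq ι] [(i : ι) → DecidableEq (W i)] [Fintype C] [Fintype ι] in
theorem not_isUniversal_inr [Nontrivial ι] [∀ i, Nonempty (W i)]
    {H : SimpleGraph (C ⊕ Σ i, W i)} (hH : H ≤ cliqueBook C W) (p : Σ i, W i) :
    ¬ IsUniversal H (Sum.inr p) := by
  obtain ⟨j, hj⟩ := exists_ne p.1
  obtain ⟨w⟩ := ‹∀ i, Nonempty (W i)› j
  intro h
  have := hH (h (Sum.inr ⟨j, w⟩) (by rintro ⟨⟩; exact hj rfl))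
  exact hj (cliqueBook_adj_inr_inr.mp this).2.symm

theorem eccMatrix_cliqueBook [Nonempty C] [Nontrivial ι] [∀ i, Nonempty (W i)] :
    eccMatrix (cliqueBook C W) = bookMatrix C W := by
  obtain ⟨c₀⟩ := ‹Nonempty C›
  have hc := isUniversal_cliqueBook (W := W) c₀
  have hr := not_isUniversal_inr (le_refl (cliqueBook C W))
  have : Nontrivial (C ⊕ Σ i, W i) :=
    ⟨Sum.inl c₀, Sum.inr ⟨Classical.arbitrary ι, Classical.arbitrary _⟩, by simp⟩
  ext u v
  rcases u with c | p <;> rcases v with d | q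
  · by_cases h : c = d
    · simp [h, eccMatrix_self]
    · simp [h, eccMatrix_of_universal (isUniversal_cliqueBook (W := W) c)]
  · simp [eccMatrix_of_universal (isUniversal_cliqueBook (W := W) c)]
  · rw [eccMatrix_comm]
    simp [eccMatrix_of_universal (isUniversal_cliqueBook (W := W) d)]
  · by_cases h : p = q
    · simp [h, eccMatrix_self]
    · by_cases h' : p.1 = q.1
      · simp [h', eccMatrix_of_adj hc (hr p) (hr q) (cliqueBook_adj_inr_inr.mpr ⟨h, h'⟩)]
      · rw [eccMatrix_of_not_adj hc (by simpa using h) (by simp [h'])]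
        simp [h']

/-- Both ends lose universality: their mutual entry rises from 1 to 2 and their entries with outer
vertices drop to 0. A third clique vertex stays universal and keeps all distances at most 2. -/
theorem eccMatrix_delete_clique_edge [Nontrivial ι] [∀ i, Nonempty (W i)]
    (hC : 3 ≤ Fintype.card C) {a b : C} (hab : a ≠ b) :
    eccMatrix ((cliqueBook C W).deleteEdges {s(Sum.inl a, Sum.inl b)})
      = bookMatrix C W + cliqueEdgeChange W a b := by
  set H := (cliqueBook C W).deleteEdges {s(Sum.inl a, Sum.inl b)} with hH
  have hu : ∀ c, c ≠ a → c ≠ b → IsUniversal H (Sum.inl c) := by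
    intro c h1 h2 v hv
    rw [hH, SimpleGraph.deleteEdges_adj]
    refine ⟨isUniversal_cliqueBook c v hv, ?_⟩
    simp [h1, h2]
  have hr := not_isUniversal_inr (SimpleGraph.deleteEdges_le (G := cliqueBook C W)
    {s(Sum.inl a, Sum.inl b)})
  have hab' : ¬ H.Adj (Sum.inl a) (Sum.inl b) := by simp [hH]
  have hna : ¬ IsUniversal H (Sum.inl a) := fun h => hab' (h _ (by simpa using hab.symm))
  have hnb : ¬ IsUniversal H (Sum.inl b) := fun h => hab' (h _ (by simpa using hab)).symm
  obtain ⟨c₀, h₀⟩ : ∃ c, c ∉ ({a, b} : Finset C) := by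
    by_contra! h
    have := Finset.card_le_card (fun c _ => h c : Finset.univ ⊆ {a, b})
    rw [Finset.card_pair hab, Finset.card_univ] at this
    omega
  simp only [Finset.mem_insert, Finset.mem_singleton, not_or] at h₀
  have hc := hu c₀ h₀.1 h₀.2
  have : Nontrivial (C ⊕ Σ i, W i) := ⟨Sum.inl a, Sum.inl b, by simpa using hab⟩
  have hlr (c : C) (q : Σ i, W i) : eccMatrix H (Sum.inl c) (Sum.inr q)
      = if c = a ∨ c = b then 0 else 1 := by
    by_cases h1 : c = a ∨ c = b
    · rw [if_pos h1]
      apply eccMatrix_of_adj hc _ (hr q)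
      · simp [hH]
      · rcases h1 with rfl | rfl <;> assumption
    · rw [if_neg h1]
      push Not at h1
      exact eccMatrix_of_universal (hu c h1.1 h1.2) (by simp)
  ext u v
  rcases u with c | p <;> rcases v with d | q
  · by_cases h : c = d
    · subst h
      by_cases h1 : c = a
      · subst h1
        simp [eccMatrix_self, cliqueEdgeChange, vecMulVec_apply, outerVec, hab]
      · simp [eccMatrix_self, cliqueEdgeChange, vecMulVec_apply, outerVec, Pi.single_apply, h1]
    · by_cases h1 : c ≠ a ∧ c ≠ b
      · rw [eccMatrix_of_universal (hu c h1.1 h1.2) (by simpa using h)]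
        simp [cliqueEdgeChange, vecMulVec_apply, outerVec, Pi.single_apply, h1, h]
      by_cases h2 : d ≠ a ∧ d ≠ b
      · rw [eccMatrix_comm, eccMatrix_of_universal (hu d h2.1 h2.2) (by simpa [eq_comm] using h)]
        simp [cliqueEdgeChange, vecMulVec_apply, outerVec, Pi.single_apply, h2, h]
      have h3 : (c = a ∧ d = b) ∨ (c = b ∧ d = a) := by grind
      rcases h3 with ⟨rfl, rfl⟩ | ⟨rfl, rfl⟩
      · rw [eccMatrix_of_not_adj hc (by simpa using h) hab']
        simp [cliqueEdgeChange, vecMulVec_apply, outerVec, h]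
        norm_num
      · rw [eccMatrix_comm, eccMatrix_of_not_adj hc (by simpa using hab) hab']
        simp [cliqueEdgeChange, vecMulVec_apply, outerVec, h]
        norm_num
  · rw [hlr]
    by_cases h1 : c = a ∨ c = b <;>
      simp [cliqueEdgeChange, vecMulVec_apply, outerVec, cliqueVec, h1]
  · rw [eccMatrix_comm, hlr]
    by_cases h1 : d = a ∨ d = b <;>
      simp [cliqueEdgeChange, vecMulVec_apply, outerVec, cliqueVec, h1]
  · have e : cliqueEdgeChange W a b (Sum.inr p) (Sum.inr q) = 0 := by
      simp [cliqueEdgeChange, vecMulVec_apply, outerVec, cliqueVec]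
    rw [Matrix.add_apply, e, add_zero]
    by_cases h : p = q
    · simp [h, eccMatrix_self]
    · by_cases h' : p.1 = q.1
      · simp [h', eccMatrix_of_adj hc (hr p) (hr q) (by simp [hH, h, h'])]
      · rw [eccMatrix_of_not_adj hc (by simpa using h) (by simp [hH, h'])]
        simp [h']

/-- Only `c` loses universality. Its entries with outer vertices drop to 0, except that the one at
`v` becomes 2; its entries in the clique stay 1 because the other clique vertices are universal. -/
theorem eccMatrix_delete_mixed_edge [Nontrivial ι] [∀ i, Nonempty (W i)]
    (hC : 2 ≤ Fintype.card C) (c : C) (v : Σ i, W i) :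
    eccMatrix ((cliqueBook C W).deleteEdges {s(Sum.inl c, Sum.inr v)})
      = bookMatrix C W + mixedEdgeChange c v := by
  set H := (cliqueBook C W).deleteEdges {s(Sum.inl c, Sum.inr v)} with hH
  have hu : ∀ d, d ≠ c → IsUniversal H (Sum.inl d) := by
    intro d h1 x hx
    rw [hH, SimpleGraph.deleteEdges_adj]
    refine ⟨isUniversal_cliqueBook d x hx, ?_⟩
    simp [h1]
  have hr := not_isUniversal_inr (SimpleGraph.deleteEdges_le (G := cliqueBook C W)
    {s(Sum.inl c, Sum.inr v)})
  have hcv : ¬ H.Adj (Sum.inl c) (Sum.inr v) := by simp [hH]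
  have hnc : ¬ IsUniversal H (Sum.inl c) := fun h => hcv (h _ (by simp))
  have : Nontrivial C := Fintype.one_lt_card_iff_nontrivial.mp hC
  obtain ⟨c₀, h₀⟩ := exists_ne c
  have hc := hu c₀ h₀
  have : Nontrivial (C ⊕ Σ i, W i) := ⟨Sum.inl c, Sum.inr v, by simp⟩
  have hlr (d : C) (q : Σ i, W i) : eccMatrix H (Sum.inl d) (Sum.inr q)
      = if d = c then (if q = v then 2 else 0) else 1 := by
    split_ifs with h1 h2
    · rw [h1, h2]
      exact eccMatrix_of_not_adj hc (by simp) hcv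
    · rw [h1]
      exact eccMatrix_of_adj hc hnc (hr q) (by simp [hH, h2])
    · exact eccMatrix_of_universal (hu d h1) (by simp)
  ext x y
  rcases x with d | p <;> rcases y with d' | q
  · have e : mixedEdgeChange c v (Sum.inl d) (Sum.inl d') = 0 := by
      simp [mixedEdgeChange, vecMulVec_apply, outerVec]
    rw [Matrix.add_apply, e, add_zero]
    by_cases h : d = d'
    · simp [h, eccMatrix_self]
    · rw [bookMatrix_inl_inl, if_neg h]
      by_cases h1 : d = c
      · rw [eccMatrix_comm]
        exact eccMatrix_of_universal (hu d' (by rw [← h1]; exact Ne.symm h))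
          (by simpa [eq_comm] using h)
      · exact eccMatrix_of_universal (hu d h1) (by simpa using h)
  · rw [hlr]
    by_cases h1 : d = c <;> by_cases h2 : q = v <;>
      simp [mixedEdgeChange, vecMulVec_apply, outerVec, cliqueVec, h1, h2]
  · rw [eccMatrix_comm, hlr]
    by_cases h1 : d' = c <;> by_cases h2 : p = v <;>
      simp [mixedEdgeChange, vecMulVec_apply, outerVec, cliqueVec, h1, h2]
  · have e : mixedEdgeChange c v (Sum.inr p) (Sum.inr q) = 0 := by
      simp [mixedEdgeChange, vecMulVec_apply, outerVec, cliqueVec]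
    rw [Matrix.add_apply, e, add_zero]
    by_cases h : p = q
    · simp [h, eccMatrix_self]
    · by_cases h' : p.1 = q.1
      · simp [h', eccMatrix_of_adj hc (hr p) (hr q) (by simp [hH, h, h'])]
      · rw [eccMatrix_of_not_adj hc (by simpa using h) (by simp [hH, h'])]
        simp [h']

theorem eccMatrix_delete_outer_edge [Nonempty C] [Nontrivial ι] [∀ i, Nonempty (W i)]
    {u v : Σ i, W i} (huv : u ≠ v) (hp : u.1 = v.1) :
    eccMatrix ((cliqueBook C W).deleteEdges {s(Sum.inr u, Sum.inr v)})
      = bookMatrix C W + outerEdgeChange C u v := by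
  set H := (cliqueBook C W).deleteEdges {s(Sum.inr u, Sum.inr v)} with hH
  have hu : ∀ d, IsUniversal H (Sum.inl d) := by
    intro d x hx
    rw [hH, SimpleGraph.deleteEdges_adj]
    refine ⟨isUniversal_cliqueBook d x hx, ?_⟩
    simp
  have hr := not_isUniversal_inr (SimpleGraph.deleteEdges_le (G := cliqueBook C W)
    {s(Sum.inr u, Sum.inr v)})
  have huv' : ¬ H.Adj (Sum.inr u) (Sum.inr v) := by simp [hH]
  obtain ⟨c₀⟩ := ‹Nonempty C›
  have hc := hu c₀
  have : Nontrivial (C ⊕ Σ i, W i) := ⟨Sum.inl c₀, Sum.inr v, by simp⟩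
  ext x y
  rcases x with d | p <;> rcases y with d' | q
  · by_cases h : d = d'
    · simp [h, eccMatrix_self, outerEdgeChange, vecMulVec_apply]
    · rw [eccMatrix_of_universal (hu d) (by simpa using h)]
      simp [outerEdgeChange, vecMulVec_apply, h]
  · rw [eccMatrix_of_universal (hu d) (by simp)]
    simp [outerEdgeChange, vecMulVec_apply]
  · rw [eccMatrix_comm, eccMatrix_of_universal (hu d') (by simp)]
    simp [outerEdgeChange, vecMulVec_apply]
  · by_cases h : p = q
    · subst h
      by_cases h1 : p = u
      · subst h1
        simp [eccMatrix_self, outerEdgeChange, vecMulVec_apply, huv]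
      · simp [eccMatrix_self, outerEdgeChange, vecMulVec_apply, Pi.single_apply, h1]
    by_cases h1 : p = u ∧ q = v
    · obtain ⟨rfl, rfl⟩ := h1
      rw [eccMatrix_of_not_adj hc (by simpa using h) huv']
      simp [outerEdgeChange, vecMulVec_apply, h, hp]
    by_cases h2 : p = v ∧ q = u
    · obtain ⟨rfl, rfl⟩ := h2
      rw [eccMatrix_comm, eccMatrix_of_not_adj hc (by simpa using huv) huv']
      simp [outerEdgeChange, vecMulVec_apply, h, hp]
    have e : outerEdgeChange C u v (Sum.inr p) (Sum.inr q) = 0 := by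
      simp only [outerEdgeChange, Matrix.add_apply, Matrix.smul_apply, vecMulVec_apply,
        Pi.single_apply, Sum.inr.injEq, smul_eq_mul]
      grind
    rw [Matrix.add_apply, e, add_zero]
    by_cases h' : p.1 = q.1
    · simp [h', eccMatrix_of_adj hc (hr p) (hr q) (by simp [hH, h, h']; tauto)]
    · rw [eccMatrix_of_not_adj hc (by simpa using h) (by simp [hH, h'])]
      simp [h']

end Book

/-! ### Energy lower bounds after deletion, one for each type of edge. -/

section Book

variable {C ι : Type*} {W : ι → Type*} [DecidableEq C] [DecidableEq ι] [∀ i, DecidableEq (W i)]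
  [Fintype C] [Fintype ι] [∀ i, Fintype (W i)]

theorem bookMatrix_form_cliqueVec (T : Finset C) :
    cliqueVec W T ⬝ᵥ (bookMatrix C W *ᵥ cliqueVec W T) = (T.card : ℝ) ^ 2 - T.card := by
  rw [bookMatrix_form]
  simp [cliqueVec]

omit [DecidableEq C] [(i : ι) → DecidableEq (W i)] [Fintype C] [Fintype ι] in
theorem sum_pageVec (i j : ι) :
    ∑ w, pageVec C W i (Sum.inr ⟨j, w⟩) = if j = i then (Fintype.card (W i) : ℝ) else 0 := by
  by_cases h : j = i
  · subst h; simp [pageVec]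
  · simp [pageVec, h]

theorem bookMatrix_form_pageVec (i : ι) :
    pageVec C W i ⬝ᵥ (bookMatrix C W *ᵥ pageVec C W i) = 0 := by
  rw [bookMatrix_form]
  simp only [sum_pageVec]
  simp [pageVec]

theorem bookMatrix_form_outerVec {n l : ℕ} (hι : Fintype.card ι = l)
    (hW : ∀ i, Fintype.card (W i) = n) :
    outerVec C W ⬝ᵥ (bookMatrix C W *ᵥ outerVec C W) = 2 * (n * l : ℝ) ^ 2 - 2 * n ^ 2 * l := by
  rw [bookMatrix_form]
  simp [outerVec, hι, hW]
  ring

theorem cliqueEdgeChange_form (a b : C) (x : C ⊕ (Σ i, W i) → ℝ) (hab : a ≠ b) :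
    x ⬝ᵥ (cliqueEdgeChange W a b *ᵥ x) = 2 * x (Sum.inl a) * x (Sum.inl b)
      - 2 * (x (Sum.inl a) + x (Sum.inl b)) * ∑ i, ∑ w, x (Sum.inr ⟨i, w⟩) := by
  simp only [cliqueEdgeChange, Matrix.sub_mulVec, Matrix.add_mulVec, dotProduct_sub,
    dotProduct_add, dotProduct_vecMulVec_mulVec, cliqueVec_dotProduct, outerVec_dotProduct,
    single_one_dotProduct, Finset.sum_pair hab]
  ring

theorem mixedEdgeChange_form (c : C) (v : Σ i, W i) (x : C ⊕ (Σ i, W i) → ℝ) :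
    x ⬝ᵥ (mixedEdgeChange c v *ᵥ x) = 4 * x (Sum.inl c) * x (Sum.inr v)
      - 2 * x (Sum.inl c) * ∑ i, ∑ w, x (Sum.inr ⟨i, w⟩) := by
  simp only [mixedEdgeChange, Matrix.sub_mulVec, Matrix.add_mulVec, dotProduct_sub,
    dotProduct_add, Matrix.smul_mulVec, dotProduct_smul, smul_eq_mul, dotProduct_vecMulVec_mulVec,
    cliqueVec_dotProduct, outerVec_dotProduct, single_one_dotProduct, Finset.sum_singleton]
  ring

theorem outerEdgeChange_form (u v : Σ i, W i) (x : C ⊕ (Σ i, W i) → ℝ) :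
    x ⬝ᵥ (outerEdgeChange C u v *ᵥ x) = 4 * x (Sum.inr u) * x (Sum.inr v) := by
  simp only [outerEdgeChange, Matrix.add_mulVec, dotProduct_add, Matrix.smul_mulVec,
    dotProduct_smul, smul_eq_mul, dotProduct_vecMulVec_mulVec, single_one_dotProduct]
  ring

omit [DecidableEq C] [DecidableEq ι] [(i : ι) → DecidableEq (W i)] [Fintype C] [Fintype ι] in
theorem page_deviation_nonneg {n : ℕ} (hW : ∀ i, Fintype.card (W i) = n)
    (x : C ⊕ (Σ i, W i) → ℝ) (i : ι) :
    0 ≤ ∑ w, x (Sum.inr ⟨i, w⟩) ^ 2 - (∑ w, x (Sum.inr ⟨i, w⟩)) ^ 2 / n := by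
  have := sq_sum_div_card_le Finset.univ fun w => x (Sum.inr (⟨i, w⟩ : Σ i, W i))
  rw [Finset.card_univ, hW] at this
  linarith

/-- With `T` the clique without `a`, `b`, the surviving directions give `n - 3 + 2n(l-1)`. The
direction `d` adds 2 and `w` adds more than 1, for a total above `n + 2n(l-1)`. -/
theorem energy_delete_clique_edge_gt {n l : ℕ} (hn : 3 ≤ n) (hl : 2 ≤ l)
    (hC : Fintype.card C = n) (hι : Fintype.card ι = l) (hW : ∀ i, Fintype.card (W i) = n)
    {a b : C} (hab : a ≠ b) (hM : (bookMatrix C W + cliqueEdgeChange W a b).IsHermitian) :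
    2 * (n + 2 * n * (l - 1)) < ∑ i, |hM.eigenvalues i| := by
  have hn' : (3 : ℝ) ≤ n := by exact_mod_cast hn
  have hl' : (2 : ℝ) ≤ l := by exact_mod_cast hl
  have hn0 : (n : ℝ) ≠ 0 := by positivity
  have hl0 : (l : ℝ) ≠ 0 := by positivity
  have hn2 : (0 : ℝ) < n - 2 := by linarith
  have hn2' := hn2.ne'
  set T : Finset C := {a, b}ᶜ with hTdef
  have hTcard : (T.card : ℝ) = n - 2 := by
    rw [hTdef, Finset.card_compl, hC, Finset.card_pair hab, Nat.cast_sub (by omega)]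
    norm_num
  have hT : T.Nonempty := by
    rw [← Finset.card_pos]; exact_mod_cast hTcard ▸ hn2
  have haT : a ∉ T := by simp [hTdef]
  have hbT : b ∉ T := by simp [hTdef]
  have hdiag : ∀ v, (bookMatrix C W + cliqueEdgeChange W a b) v v = 0 := by
    rintro (c | p)
    · by_cases h1 : c = a
      · subst h1
        simp [cliqueEdgeChange, vecMulVec_apply, outerVec, hab]
      · simp [cliqueEdgeChange, vecMulVec_apply, outerVec, Pi.single_apply, h1]
    · simp [cliqueEdgeChange, vecMulVec_apply, cliqueVec]
  set d : C ⊕ (Σ i, W i) → ℝ := Pi.single (Sum.inl a) 1 - Pi.single (Sum.inl b) 1 with hd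
  -- Constant on `{a, b}`, on `T` and outside, hence orthogonal to all other test directions; `N` is
  -- its squared norm. Its clique sum is 2, and its outer sum `-3` then minimises the terms `2 Z ^ 2
  -- + 12 Z` of the form.
  set w : C ⊕ (Σ i, W i) → ℝ := (-2 : ℝ) • cliqueVec W {a, b} + (6 / (n - 2 : ℝ)) • cliqueVec W T
    + (-3 / (n * l : ℝ)) • outerVec C W with hw
  set N : ℝ := 8 + 36 / (n - 2) + 9 / (n * l) with hN
  have hNpos : 0 < N := by positivity
  have hdx (x : C ⊕ (Σ i, W i) → ℝ) : d ⬝ᵥ x = x (Sum.inl a) - x (Sum.inl b) := by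
    simp [hd, sub_dotProduct]
  have hwx (x : C ⊕ (Σ i, W i) → ℝ) : w ⬝ᵥ x = -2 * (x (Sum.inl a) + x (Sum.inl b))
      + 6 / (n - 2) * ∑ c ∈ T, x (Sum.inl c)
      + -3 / (n * l) * ∑ i, ∑ w, x (Sum.inr ⟨i, w⟩) := by
    simp only [hw, add_dotProduct, smul_dotProduct, cliqueVec_dotProduct, outerVec_dotProduct,
      Finset.sum_pair hab, smul_eq_mul]
  have hR (x : C ⊕ (Σ i, W i) → ℝ) :
      x ⬝ᵥ (((1 / 2 : ℝ) • vecMulVec d d + (1 / N) • vecMulVec w w) *ᵥ x)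
        = (d ⬝ᵥ x) ^ 2 / 2 + (w ⬝ᵥ x) ^ 2 / N := by
    simp only [Matrix.add_mulVec, dotProduct_add, Matrix.smul_mulVec,
      dotProduct_smul, smul_eq_mul, dotProduct_vecMulVec_mulVec]
    ring
  have key := le_sum_abs_eigenvalues_book (n := n) (l := l) (by omega) (by omega) hι hT hM hdiag
    (R := (1 / 2 : ℝ) • vecMulVec d d + (1 / N) • vecMulVec w w)
    (fun x => by rw [hR]; positivity) (fun x => ?_)
  · refine lt_of_lt_of_le ?_ key
    have e1 : cliqueVec W T ⬝ᵥ ((bookMatrix C W + cliqueEdgeChange W a b) *ᵥ cliqueVec W T)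
        = (n - 2) ^ 2 - (n - 2) := by
      rw [Matrix.add_mulVec, dotProduct_add, bookMatrix_form_cliqueVec,
        cliqueEdgeChange_form _ _ _ hab, hTcard]
      simp [cliqueVec, haT, hbT]
    have e2 : ∑ i, pageVec C W i ⬝ᵥ
        ((bookMatrix C W + cliqueEdgeChange W a b) *ᵥ pageVec C W i) = 0 := by
      refine Finset.sum_eq_zero fun i _ => ?_
      rw [Matrix.add_mulVec, dotProduct_add, bookMatrix_form_pageVec,
        cliqueEdgeChange_form _ _ _ hab]
      simp [pageVec]
    have e3 : outerVec C W ⬝ᵥ ((bookMatrix C W + cliqueEdgeChange W a b) *ᵥ outerVec C W)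
        = 2 * (n * l : ℝ) ^ 2 - 2 * n ^ 2 * l := by
      rw [Matrix.add_mulVec, dotProduct_add, bookMatrix_form_outerVec hι hW,
        cliqueEdgeChange_form _ _ _ hab]
      simp [outerVec]
    have e4 : d ⬝ᵥ ((bookMatrix C W + cliqueEdgeChange W a b) *ᵥ d) = -4 := by
      have s1 : ∑ c, d (Sum.inl c) = 0 := by
        rw [← Finset.sum_compl_add_sum {a, b}, Finset.sum_pair hab,
          Finset.sum_eq_zero (s := {a, b}ᶜ)]
        · simp [hd, hab, hab.symm]
        · intro c hc
          simp only [Finset.mem_compl, Finset.mem_insert, Finset.mem_singleton, not_or] at hc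
          simp [hd, hc]
      have s2 : ∑ c, d (Sum.inl c) ^ 2 = 2 := by
        rw [← Finset.sum_compl_add_sum {a, b}, Finset.sum_pair hab,
          Finset.sum_eq_zero (s := {a, b}ᶜ)]
        · simp [hd, hab, hab.symm]; norm_num
        · intro c hc
          simp only [Finset.mem_compl, Finset.mem_insert, Finset.mem_singleton, not_or] at hc
          simp [hd, hc]
      have s3 : ∀ p, d (Sum.inr p) = 0 := fun p => by simp [hd]
      rw [Matrix.add_mulVec, dotProduct_add, bookMatrix_form, cliqueEdgeChange_form _ _ _ hab,
        s1, s2]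
      simp only [s3]
      simp [hd, hab, hab.symm]
      norm_num
    -- A negative right side means that the Rayleigh quotient of `w` is below `-1`.
    have e5 : w ⬝ᵥ ((bookMatrix C W + cliqueEdgeChange W a b) *ᵥ w) + N
        = -6 + 9 * (1 / n - 2) / l := by
      have wa : w (Sum.inl a) = -2 := by simp [hw, cliqueVec, outerVec, haT]
      have wb : w (Sum.inl b) = -2 := by simp [hw, cliqueVec, outerVec, hbT]
      have wT : ∀ c ∈ T, w (Sum.inl c) = 6 / (n - 2) := by
        intro c hc
        have : ¬ (c = a ∨ c = b) := by simpa [hTdef] using hc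
        simp [hw, cliqueVec, outerVec, hc, this]
      have wr : ∀ p, w (Sum.inr p) = -3 / (n * l) := by
        intro p; simp [hw, cliqueVec, outerVec]
      have s1 : ∑ c, w (Sum.inl c) = 2 := by
        rw [← Finset.sum_compl_add_sum {a, b}, Finset.sum_pair hab, Finset.sum_congr rfl wT,
          wa, wb, Finset.sum_const, nsmul_eq_mul, hTcard]
        field_simp
        ring
      have s2 : ∑ c, w (Sum.inl c) ^ 2 = 36 / (n - 2) + 8 := by
        rw [← Finset.sum_compl_add_sum {a, b}, Finset.sum_pair hab,
          Finset.sum_congr rfl fun c hc => by rw [wT c hc],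
          wa, wb, Finset.sum_const, nsmul_eq_mul, hTcard]
        field_simp
        ring
      rw [Matrix.add_mulVec, dotProduct_add, bookMatrix_form, cliqueEdgeChange_form _ _ _ hab,
        s1, s2, wa, wb]
      simp only [wr, Finset.sum_const, Finset.card_univ, hW, hι, nsmul_eq_mul, hN]
      field_simp
      ring
    rw [e1, e2, e3, Matrix.add_mul, Matrix.trace_add, Matrix.smul_mul, Matrix.smul_mul,
      Matrix.trace_smul, Matrix.trace_smul, trace_vecMulVec_mul, trace_vecMulVec_mul, e4, hTcard]
    have hneg : 9 * (1 / (n : ℝ) - 2) / l ≤ 0 := by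
      apply div_nonpos_of_nonpos_of_nonneg _ (by positivity)
      have : 1 / (n : ℝ) ≤ 1 := by rw [div_le_one (by positivity)]; linarith
      linarith
    have h1 : 1 / N * (w ⬝ᵥ ((bookMatrix C W + cliqueEdgeChange W a b) *ᵥ w)) < -1 := by
      rw [one_div_mul_eq_div, div_lt_iff₀ hNpos]
      linarith
    have f1 : (((n : ℝ) - 2) ^ 2 - (n - 2)) / (n - 2) = n - 3 := by field_simp; ring
    have f2 : (2 * (n * l : ℝ) ^ 2 - 2 * n ^ 2 * l) / (n * l) = 2 * n * (l - 1) := by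
      field_simp
    rw [f1, f2]
    simp only [smul_eq_mul, zero_div]
    linarith
  · rw [hR, hdx, hwx]
    have hTc : Tᶜ = {a, b} := by simp [hTdef]
    rw [hTc, Finset.sum_pair hab, hTcard]
    have hpages := Finset.sum_nonneg fun i (_ : i ∈ Finset.univ) => page_deviation_nonneg hW x i
    set X := ∑ c ∈ T, x (Sum.inl c)
    set Z := ∑ i, ∑ w, x (Sum.inr ⟨i, w⟩)
    set s := x (Sum.inl a) + x (Sum.inl b) with hs
    -- The three summands of `N` are the squared norms of the pieces of `w` on `{a, b}`, on `T` and
    -- outside; `d` takes the remaining direction of `{a, b}`.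
    have t1 := add_sq_div_add_le (a := -2 * s + 6 / (n - 2) * X) (b := -3 / (n * l) * Z)
      (p := 8 + 36 / (n - 2)) (q := 9 / (n * l)) (by positivity) (by positivity)
    have t2 := add_sq_div_add_le (a := -2 * s) (b := 6 / (n - 2) * X)
      (p := 8) (q := 36 / (n - 2)) (by positivity) (by positivity)
    have g1 : (-2 * s) ^ 2 / 8 = s ^ 2 / 2 := by ring
    have g2 : (6 / (n - 2) * X) ^ 2 / (36 / (n - 2)) = X ^ 2 / (n - 2) := by
      field_simp; ring
    have g3 : (-3 / (n * l) * Z) ^ 2 / (9 / (n * l)) = Z ^ 2 / (n * l) := by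
      field_simp; ring
    have g4 : (x (Sum.inl a) - x (Sum.inl b)) ^ 2 / 2 + s ^ 2 / 2
        = x (Sum.inl a) ^ 2 + x (Sum.inl b) ^ 2 := by rw [hs]; ring
    rw [g3] at t1
    rw [g1, g2] at t2
    rw [hN]
    linarith

/-- The surviving directions give `n - 2 + 2n(l-1)`, so a single new direction with Rayleigh
quotient below `-2` suffices. -/
theorem energy_delete_mixed_edge_gt {n l : ℕ} (hn : 3 ≤ n) (hl : 2 ≤ l)
    (hC : Fintype.card C = n) (hι : Fintype.card ι = l) (hW : ∀ i, Fintype.card (W i) = n)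
    (c : C) (v : Σ i, W i) (hM : (bookMatrix C W + mixedEdgeChange c v).IsHermitian) :
    2 * (n + 2 * n * (l - 1)) < ∑ i, |hM.eigenvalues i| := by
  have hn' : (3 : ℝ) ≤ n := by exact_mod_cast hn
  have hl' : (2 : ℝ) ≤ l := by exact_mod_cast hl
  have hn0 : (n : ℝ) ≠ 0 := by positivity
  have hl0 : (l : ℝ) ≠ 0 := by positivity
  have hn1 : (0 : ℝ) < n - 1 := by linarith
  have hn1' := hn1.ne'
  obtain ⟨i₀, w₀⟩ := v
  set T : Finset C := {c}ᶜ with hTdef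
  have hTcard : (T.card : ℝ) = n - 1 := by
    rw [hTdef, Finset.card_compl, hC, Finset.card_singleton, Nat.cast_sub (by omega)]
    norm_num
  have hT : T.Nonempty := by
    rw [← Finset.card_pos]; exact_mod_cast hTcard ▸ hn1
  have hcT : c ∉ T := by simp [hTdef]
  have hdiag : ∀ u, (bookMatrix C W + mixedEdgeChange c ⟨i₀, w₀⟩) u u = 0 := by
    rintro (d | p)
    · simp [mixedEdgeChange, vecMulVec_apply, outerVec]
    · simp [mixedEdgeChange, vecMulVec_apply, cliqueVec]
  -- Opposite signs at `c` and `v` exploit the new entry 2. The clique sum is 0 and each page has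
  -- the same sum, so `w` is orthogonal to the old directions. The outer sum `1 / 2` minimises `2 Z
  -- ^ 2 - 2 Z`, the outer terms of the form without those carrying a factor `1 / l`.
  set w : C ⊕ (Σ i, W i) → ℝ := cliqueVec W {c} + (-1 / (n - 1 : ℝ)) • cliqueVec W T
    + (1 / (2 * n * l : ℝ)) • outerVec C W + (1 / (n : ℝ)) • pageVec C W i₀
    - Pi.single (Sum.inr ⟨i₀, w₀⟩) 1 with hw
  set N : ℝ := 1 + 1 / (n - 1) + 1 / (4 * n * l) + (n - 1) / n with hN
  have hNpos : 0 < N := by positivity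
  have hwx (x : C ⊕ (Σ i, W i) → ℝ) : w ⬝ᵥ x = x (Sum.inl c)
      + -1 / (n - 1) * ∑ d ∈ T, x (Sum.inl d)
      + 1 / (2 * n * l) * (∑ i, ∑ w, x (Sum.inr ⟨i, w⟩))
      + - (x (Sum.inr ⟨i₀, w₀⟩) - (∑ w, x (Sum.inr ⟨i₀, w⟩)) / n) := by
    simp only [hw, add_dotProduct, sub_dotProduct, smul_dotProduct, cliqueVec_dotProduct,
      outerVec_dotProduct, pageVec_dotProduct, single_one_dotProduct, Finset.sum_singleton,
      smul_eq_mul]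
    ring
  have hR (x : C ⊕ (Σ i, W i) → ℝ) :
      x ⬝ᵥ (((1 / N) • vecMulVec w w) *ᵥ x) = (w ⬝ᵥ x) ^ 2 / N := by
    simp only [Matrix.smul_mulVec, dotProduct_smul, smul_eq_mul, dotProduct_vecMulVec_mulVec]
    ring
  have key := le_sum_abs_eigenvalues_book (n := n) (l := l) (by omega) (by omega) hι hT hM hdiag
    (R := (1 / N) • vecMulVec w w) (fun x => by rw [hR]; positivity) (fun x => ?_)
  · refine lt_of_lt_of_le ?_ key
    have e1 : cliqueVec W T ⬝ᵥ
        ((bookMatrix C W + mixedEdgeChange c ⟨i₀, w₀⟩) *ᵥ cliqueVec W T)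
        = (n - 1) ^ 2 - (n - 1) := by
      rw [Matrix.add_mulVec, dotProduct_add, bookMatrix_form_cliqueVec, mixedEdgeChange_form,
        hTcard]
      simp [cliqueVec, hcT]
    have e2 : ∑ i, pageVec C W i ⬝ᵥ
        ((bookMatrix C W + mixedEdgeChange c ⟨i₀, w₀⟩) *ᵥ pageVec C W i) = 0 := by
      refine Finset.sum_eq_zero fun i _ => ?_
      rw [Matrix.add_mulVec, dotProduct_add, bookMatrix_form_pageVec, mixedEdgeChange_form]
      simp [pageVec]
    have e3 : outerVec C W ⬝ᵥ
        ((bookMatrix C W + mixedEdgeChange c ⟨i₀, w₀⟩) *ᵥ outerVec C W)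
        = 2 * (n * l : ℝ) ^ 2 - 2 * n ^ 2 * l := by
      rw [Matrix.add_mulVec, dotProduct_add, bookMatrix_form_outerVec hι hW, mixedEdgeChange_form]
      simp [outerVec]
    have e5 : w ⬝ᵥ ((bookMatrix C W + mixedEdgeChange c ⟨i₀, w₀⟩) *ᵥ w) + 2 * N
        = 1 / (n - 1) + 2 / n - 3 / 2 + (5 - n) / (2 * n * l) := by
      have wc : w (Sum.inl c) = 1 := by simp [hw, cliqueVec, outerVec, pageVec, hcT]
      have wT : ∀ d ∈ T, w (Sum.inl d) = -1 / (n - 1) := by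
        intro d hd
        have : d ≠ c := by simpa [hTdef] using hd
        simp [hw, cliqueVec, outerVec, pageVec, hd, this]
      have wv : w (Sum.inr ⟨i₀, w₀⟩) = 1 / (2 * n * l) + 1 / n - 1 := by
        simp [hw, cliqueVec, outerVec, pageVec]
      have wS : ∀ i, ∑ u, w (Sum.inr ⟨i, u⟩) = 1 / (2 * l) := by
        intro i
        rw [← pageVec_dotProduct (C := C), dotProduct_comm, hwx]
        simp only [sum_pageVec, hW]
        by_cases h : i₀ = i
        · subst h
          simp [pageVec]
          field_simp
          ring
        · simp [pageVec, h]
          field_simp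
      have s1 : ∑ d, w (Sum.inl d) = 0 := by
        rw [← Finset.sum_compl_add_sum {c}, Finset.sum_singleton, Finset.sum_congr rfl wT,
          wc, Finset.sum_const, nsmul_eq_mul, hTcard]
        field_simp
        ring
      have s2 : ∑ d, w (Sum.inl d) ^ 2 = 1 / (n - 1) + 1 := by
        rw [← Finset.sum_compl_add_sum {c}, Finset.sum_singleton,
          Finset.sum_congr rfl fun c hc => by rw [wT c hc],
          wc, Finset.sum_const, nsmul_eq_mul, hTcard]
        field_simp
      rw [Matrix.add_mulVec, dotProduct_add, bookMatrix_form, mixedEdgeChange_form, s1, s2, wc, wv]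
      simp only [wS, Finset.sum_const, Finset.card_univ, hι, nsmul_eq_mul, hN]
      field_simp
      ring
    rw [e1, e2, e3, Matrix.smul_mul, Matrix.trace_smul, trace_vecMulVec_mul, hTcard]
    have hneg : 1 / ((n : ℝ) - 1) + 2 / n - 3 / 2 + (5 - n) / (2 * n * l) < 0 := by
      have e : 1 / ((n : ℝ) - 1) + 2 / n - 3 / 2 + (5 - n) / (2 * n * l)
          = (2 * n * l + 4 * (n - 1) * l - 3 * n * (n - 1) * l + (5 - n) * (n - 1))
            / (2 * n * l * (n - 1)) := by
        field_simp
        ring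
      rw [e]
      apply div_neg_of_neg_of_pos _ (by positivity)
      -- Shifting to `m = n - 3 ≥ 0` turns the hypothesis on `n` into signs of monomials.
      obtain ⟨m, hm⟩ : ∃ m : ℝ, (n : ℝ) = m + 3 := ⟨n - 3, by ring⟩
      have hm0 : 0 ≤ m := by linarith
      rw [hm]
      have : 0 ≤ m * l := by positivity
      have : 0 ≤ m * m * l := by positivity
      nlinarith
    have h1 : 1 / N * (w ⬝ᵥ ((bookMatrix C W + mixedEdgeChange c ⟨i₀, w₀⟩) *ᵥ w)) < -2 := by
      rw [one_div_mul_eq_div, div_lt_iff₀ hNpos]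
      linarith
    have f1 : (((n : ℝ) - 1) ^ 2 - (n - 1)) / (n - 1) = n - 2 := by field_simp; ring
    have f2 : (2 * (n * l : ℝ) ^ 2 - 2 * n ^ 2 * l) / (n * l) = 2 * n * (l - 1) := by
      field_simp
    rw [f1, f2]
    simp only [smul_eq_mul, zero_div]
    linarith
  · rw [hR, hwx]
    have hTc : Tᶜ = {c} := by simp [hTdef]
    rw [hTc, Finset.sum_singleton, hTcard]
    have hpage := sq_sub_mean_le (by omega : 2 ≤ n) (hW i₀)
      (fun w => x (Sum.inr (⟨i₀, w⟩ : Σ i, W i))) w₀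
    have hpages := Finset.single_le_sum (fun i (_ : i ∈ Finset.univ) =>
      page_deviation_nonneg hW x i) (Finset.mem_univ i₀)
    set X := ∑ d ∈ T, x (Sum.inl d)
    set Z := ∑ i, ∑ w, x (Sum.inr ⟨i, w⟩)
    set y := x (Sum.inr ⟨i₀, w₀⟩) - (∑ w, x (Sum.inr ⟨i₀, w⟩)) / n
    have t1 := add_sq_div_add_le (a := x (Sum.inl c) + -1 / (n - 1) * X + 1 / (2 * n * l) * Z)
      (b := - y) (p := 1 + 1 / (n - 1) + 1 / (4 * n * l)) (q := (n - 1) / n)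
      (by positivity) (by positivity)
    have t2 := add_sq_div_add_le (a := x (Sum.inl c) + -1 / (n - 1) * X) (b := 1 / (2 * n * l) * Z)
      (p := 1 + 1 / (n - 1)) (q := 1 / (4 * n * l)) (by positivity) (by positivity)
    have t3 := add_sq_div_add_le (a := x (Sum.inl c)) (b := -1 / (n - 1) * X)
      (p := 1) (q := 1 / (n - 1)) (by positivity) (by positivity)
    have g1 : (-1 / (n - 1) * X) ^ 2 / (1 / (n - 1)) = X ^ 2 / (n - 1) := by
      field_simp
    have g2 : (1 / (2 * n * l) * Z) ^ 2 / (1 / (4 * n * l)) = Z ^ 2 / (n * l) := by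
      field_simp; ring
    rw [neg_sq] at t1
    rw [g2] at t2
    rw [g1, div_one] at t3
    rw [hN]
    linarith

/-- All old directions are kept, and the difference of the two end vectors adds 2. The loss `4 / n -
4 / (n * l)` arises because the new entries 2 lie inside a page and raise the forms of the
page-constant vectors. -/
theorem energy_delete_outer_edge_ge {n l : ℕ} (hn : 3 ≤ n) (hl : 2 ≤ l)
    (hC : Fintype.card C = n) (hι : Fintype.card ι = l) (hW : ∀ i, Fintype.card (W i) = n)
    {u v : Σ i, W i} (huv : u ≠ v) (hp : u.1 = v.1)
    (hM : (bookMatrix C W + outerEdgeChange C u v).IsHermitian) :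
    2 * (n + 1 + 2 * n * (l - 1) - 4 / n + 4 / (n * l)) ≤ ∑ i, |hM.eigenvalues i| := by
  have hn' : (3 : ℝ) ≤ n := by exact_mod_cast hn
  have hl' : (2 : ℝ) ≤ l := by exact_mod_cast hl
  have hn0 : (n : ℝ) ≠ 0 := by positivity
  have hl0 : (l : ℝ) ≠ 0 := by positivity
  obtain ⟨i₀, u₀⟩ := u
  obtain ⟨j₀, v₀⟩ := v
  obtain rfl : i₀ = j₀ := hp
  have huv₀ : u₀ ≠ v₀ := by rintro rfl; exact huv rfl
  have hTcard : ((Finset.univ : Finset C).card : ℝ) = n := by rw [Finset.card_univ, hC]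
  have hT : (Finset.univ : Finset C).Nonempty := by
    rw [← Finset.card_pos, Finset.card_univ]; omega
  have hdiag : ∀ x, (bookMatrix C W + outerEdgeChange C ⟨i₀, u₀⟩ ⟨i₀, v₀⟩) x x = 0 := by
    rintro (c | p)
    · simp [outerEdgeChange, vecMulVec_apply]
    · by_cases h1 : p = ⟨i₀, u₀⟩
      · subst h1
        simp [outerEdgeChange, vecMulVec_apply, huv₀]
      · simp [outerEdgeChange, vecMulVec_apply, Pi.single_apply, h1]
  set d : C ⊕ (Σ i, W i) → ℝ :=
    Pi.single (Sum.inr ⟨i₀, u₀⟩) 1 - Pi.single (Sum.inr ⟨i₀, v₀⟩) 1 with hd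
  have hdx (x : C ⊕ (Σ i, W i) → ℝ) :
      d ⬝ᵥ x = x (Sum.inr ⟨i₀, u₀⟩) - x (Sum.inr ⟨i₀, v₀⟩) := by
    simp [hd, sub_dotProduct]
  have hR (x : C ⊕ (Σ i, W i) → ℝ) :
      x ⬝ᵥ (((1 / 2 : ℝ) • vecMulVec d d) *ᵥ x) = (d ⬝ᵥ x) ^ 2 / 2 := by
    simp only [Matrix.smul_mulVec, dotProduct_smul, smul_eq_mul, dotProduct_vecMulVec_mulVec]
    ring
  have key := le_sum_abs_eigenvalues_book (n := n) (l := l) (by omega) (by omega) hι hT hM hdiag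
    (R := (1 / 2 : ℝ) • vecMulVec d d) (fun x => by rw [hR]; positivity) (fun x => ?_)
  · refine le_trans (le_of_eq ?_) key
    have e1 : cliqueVec W Finset.univ ⬝ᵥ ((bookMatrix C W
        + outerEdgeChange C ⟨i₀, u₀⟩ ⟨i₀, v₀⟩) *ᵥ cliqueVec W Finset.univ) = n ^ 2 - n := by
      rw [Matrix.add_mulVec, dotProduct_add, bookMatrix_form_cliqueVec, outerEdgeChange_form,
        hTcard]
      simp [cliqueVec]
    have e2 : ∑ i, pageVec C W i ⬝ᵥ ((bookMatrix C W
        + outerEdgeChange C ⟨i₀, u₀⟩ ⟨i₀, v₀⟩) *ᵥ pageVec C W i) = 4 := by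
      simp only [Matrix.add_mulVec, dotProduct_add, bookMatrix_form_pageVec, outerEdgeChange_form]
      simp [pageVec]
    have e3 : outerVec C W ⬝ᵥ ((bookMatrix C W
        + outerEdgeChange C ⟨i₀, u₀⟩ ⟨i₀, v₀⟩) *ᵥ outerVec C W)
        = 2 * (n * l : ℝ) ^ 2 - 2 * n ^ 2 * l + 4 := by
      rw [Matrix.add_mulVec, dotProduct_add, bookMatrix_form_outerVec hι hW, outerEdgeChange_form]
      simp [outerVec]
    have e4 : d ⬝ᵥ ((bookMatrix C W + outerEdgeChange C ⟨i₀, u₀⟩ ⟨i₀, v₀⟩) *ᵥ d) = -4 := by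
      have s1 : ∀ c, d (Sum.inl c) = 0 := fun c => by simp [hd]
      have s2 : ∀ i, ∑ w, d (Sum.inr ⟨i, w⟩) = 0 := by
        intro i
        rw [← pageVec_dotProduct (C := C), dotProduct_comm, hdx]
        simp [pageVec]
      rw [Matrix.add_mulVec, dotProduct_add, bookMatrix_form, outerEdgeChange_form]
      simp only [s1, s2]
      simp [hd, huv₀, huv₀.symm]
    rw [e1, e2, e3, Matrix.smul_mul, Matrix.trace_smul, trace_vecMulVec_mul, e4, hTcard]
    simp only [smul_eq_mul]
    field_simp
    ring
  · rw [hR, hdx]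
    have hpage := sq_sub_div_two_le hn (hW i₀)
      (fun w => x (Sum.inr (⟨i₀, w⟩ : Σ i, W i))) huv₀
    have hpages := Finset.single_le_sum (fun i (_ : i ∈ Finset.univ) =>
      page_deviation_nonneg hW x i) (Finset.mem_univ i₀)
    rw [hTcard]
    have h1 : 0 ≤ (∑ c, x (Sum.inl c)) ^ 2 / (n : ℝ) := by positivity
    have h2 : 0 ≤ (∑ i, ∑ w, x (Sum.inr ⟨i, w⟩)) ^ 2 / (n * l : ℝ) := by positivity
    rw [Finset.compl_univ, Finset.sum_empty]
    linarith

end Book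

/-! ### The coalescence of complete graphs as cliques sharing a clique. -/

open Classical in
theorem coalIncl_apply_embedding {ι : Type*} {k : ℕ} {V : ι → Type*} {G : ∀ i, SimpleGraph (V i)}
    (f : ∀ i, (⊤ : SimpleGraph (Fin k)) ↪g G i) (i : ι) (a : Fin k) :
    coalIncl f i (f i a) = Sum.inl a := by
  have h : f i a ∈ Set.range (f i) := ⟨a, rfl⟩
  rw [coalIncl, dif_pos h]
  exact congrArg _ ((f i).injective h.choose_spec)

theorem coalIncl_of_notMem {ι : Type*} {k : ℕ} {V : ι → Type*} {G : ∀ i, SimpleGraph (V i)}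
    (f : ∀ i, (⊤ : SimpleGraph (Fin k)) ↪g G i) (i : ι) {v : V i} (h : v ∉ Set.range (f i)) :
    coalIncl f i v = Sum.inr ⟨i, v, h⟩ := by
  rw [coalIncl, dif_neg h]

/-- The coalescence of complete graphs consists of cliques that share a clique. -/
theorem coalescence_top {ι : Type*} [Nonempty ι] {k : ℕ} {V : ι → Type*}
    (f : ∀ i, (⊤ : SimpleGraph (Fin k)) ↪g (⊤ : SimpleGraph (V i))) :
    coalescence f = cliqueBook (Fin k) fun i => {v : V i // v ∉ Set.range (f i)} := by
  ext x y
  simp only [coalescence, SimpleGraph.iSup_adj]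
  constructor
  · rintro ⟨i, -, u, v, huv, rfl, rfl⟩
    rw [SimpleGraph.top_adj] at huv
    by_cases hu : u ∈ Set.range (f i) <;> by_cases hv : v ∈ Set.range (f i)
    · obtain ⟨a, rfl⟩ := hu
      obtain ⟨b, rfl⟩ := hv
      simp only [coalIncl_apply_embedding, cliqueBook_adj_inl_inl]
      rintro rfl; exact huv rfl
    · obtain ⟨a, rfl⟩ := hu
      simp [coalIncl_apply_embedding, coalIncl_of_notMem f i hv]
    · obtain ⟨b, rfl⟩ := hv
      simp [coalIncl_apply_embedding, coalIncl_of_notMem f i hu]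
    · simpa [coalIncl_of_notMem f i hv, coalIncl_of_notMem f i hu] using huv
  · intro h
    rcases x with a | ⟨i, u, hu⟩ <;> rcases y with b | ⟨j, v, hv⟩
    -- An edge of the common clique comes from any of the copies, so at least one is needed.
    · obtain ⟨i⟩ := ‹Nonempty ι›
      refine ⟨i, h.ne, f i a, f i b, ?_, coalIncl_apply_embedding f i a,
        coalIncl_apply_embedding f i b⟩
      simpa using h
    · refine ⟨j, h.ne, f j a, v, ?_, coalIncl_apply_embedding f j a, coalIncl_of_notMem f j hv⟩
      rw [SimpleGraph.top_adj]
      rintro rfl; exact hv ⟨a, rfl⟩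
    · refine ⟨i, h.ne, u, f i b, ?_, coalIncl_of_notMem f i hu, coalIncl_apply_embedding f i b⟩
      rw [SimpleGraph.top_adj]
      rintro rfl; exact hu ⟨b, rfl⟩
    · obtain ⟨h1, h2⟩ := cliqueBook_adj_inr_inr.mp h
      obtain rfl : i = j := h2
      refine ⟨i, h.ne, u, v, ?_, coalIncl_of_notMem f i hu, coalIncl_of_notMem f i hv⟩
      rw [SimpleGraph.top_adj]
      rintro rfl; exact h1 rfl

/-- Also reconciles the classical decidable equality inside `eccEnergy` with the given instance. -/
theorem eccEnergy_eq {V : Type*} [Fintype V] [DecidableEq V] {G : SimpleGraph V}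
    {M : Matrix V V ℝ} (h : eccMatrix G = M) (hM : M.IsHermitian) :
    eccEnergy G = ∑ i, |hM.eigenvalues i| := by
  subst h
  unfold eccEnergy
  congr!

/-! ### Comparison of the bounds and the main theorem. -/

/-- Deleting an edge of cliques that share a clique increases the eccentricity energy. -/
theorem eccEnergy_cliqueBook_lt {C ι : Type*} {W : ι → Type*} [Fintype C] [Fintype ι]
    [∀ i, Fintype (W i)] {n l : ℕ} (hn : 3 ≤ n) (hl : 2 ≤ l)
    (hC : Fintype.card C = n) (hι : Fintype.card ι = l) (hW : ∀ i, Fintype.card (W i) = n)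
    (e : Sym2 (C ⊕ Σ i, W i)) (he : e ∈ (cliqueBook C W).edgeSet) :
    eccEnergy (cliqueBook C W) < eccEnergy ((cliqueBook C W).deleteEdges {e}) := by
  classical
  have hn' : (3 : ℝ) ≤ n := by exact_mod_cast hn
  have hl' : (2 : ℝ) ≤ l := by exact_mod_cast hl
  have : Nontrivial ι := Fintype.one_lt_card_iff_nontrivial.mp (by omega)
  have : Nonempty C := Fintype.card_pos_iff.mp (by omega)
  have : ∀ i, Nonempty (W i) := fun i => Fintype.card_pos_iff.mp (by rw [hW]; omega)
  have hG := eccMatrix_cliqueBook (C := C) (W := W)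
  have hGM := hG ▸ eccMatrix_isHermitian (cliqueBook C W)
  have upper (t : ℝ) (ht : 0 ≤ t) (htl : (l : ℝ) * n ≤ 2 * (n - 1 + t) * (l - 1)) :
      eccEnergy (cliqueBook C W) ≤ 2 * (n - 1 + t + 2 * n * (l - 1)) := by
    rw [eccEnergy_eq hG hGM]
    exact sum_abs_eigenvalues_book_le (by omega) hl ht htl (by linarith) hC hι hW hGM
  have upper_one : eccEnergy (cliqueBook C W) ≤ 2 * (n + 2 * n * (l - 1)) := by
    have := upper 1 zero_le_one (by nlinarith)
    linarith
  have mixed (c : C) (v : Σ i, W i) : eccEnergy (cliqueBook C W) <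
      eccEnergy ((cliqueBook C W).deleteEdges {s(Sum.inl c, Sum.inr v)}) := by
    have h := eccMatrix_delete_mixed_edge (by omega) c v
    have hM := h ▸ eccMatrix_isHermitian
      ((cliqueBook C W).deleteEdges {s(Sum.inl c, Sum.inr v)})
    rw [eccEnergy_eq h hM]
    exact upper_one.trans_lt (energy_delete_mixed_edge_gt hn hl hC hι hW c v hM)
  induction e with | _ x y
  rw [SimpleGraph.mem_edgeSet] at he
  rcases x with a | u <;> rcases y with b | v
  · have hab := cliqueBook_adj_inl_inl.mp he
    have h := eccMatrix_delete_clique_edge (W := W) (by omega) hab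
    have hM := h ▸ eccMatrix_isHermitian
      ((cliqueBook C W).deleteEdges {s(Sum.inl a, Sum.inl b)})
    rw [eccEnergy_eq h hM]
    exact upper_one.trans_lt (energy_delete_clique_edge_gt hn hl hC hι hW hab hM)
  · exact mixed a v
  · rw [Sym2.eq_swap]
    exact mixed b u
  · obtain ⟨huv, hp⟩ := cliqueBook_adj_inr_inr.mp he
    have h := eccMatrix_delete_outer_edge (C := C) huv hp
    have hM := h ▸ eccMatrix_isHermitian
      ((cliqueBook C W).deleteEdges {s(Sum.inr u, Sum.inr v)})
    rw [eccEnergy_eq h hM]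
    refine lt_of_lt_of_le ?_ (energy_delete_outer_edge_ge hn hl hC hι hW huv hp hM)
    have e : (4 : ℝ) / n - 4 / (n * l) = 4 * (l - 1) / (n * l) := by field_simp
    -- For `l ≤ 3` the loss is below 1, so the bound with `t = 1` suffices. At `n = 3`, `l = 4` the
    -- loss equals 1, but from `l = 4` on `t = 0` is admissible, which leaves room for a loss below
    -- 2.
    by_cases h3 : l ≤ 3
    · have h3' : (l : ℝ) ≤ 3 := by exact_mod_cast h3
      have : 4 * ((l : ℝ) - 1) / (n * l) < 1 := by
        rw [div_lt_one (by positivity)]; nlinarith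
      linarith
    · have h3' : (4 : ℝ) ≤ l := by exact_mod_cast (by omega : 4 ≤ l)
      have : 4 * ((l : ℝ) - 1) / (n * l) < 2 := by
        rw [div_lt_iff₀ (by positivity)]; nlinarith
      have := upper 0 le_rfl (by nlinarith)
      linarith

open Classical in
theorem mainTheorem1 (n l : ℕ) (hn : 3 ≤ n) (hl : 2 ≤ l)
    (f : Fin l → ((⊤ : SimpleGraph (Fin n)) ↪g (⊤ : SimpleGraph (Fin (2 * n)))))
    (e : Sym2 (CoalVert f)) (he : e ∈ (coalescence f).edgeSet) :
    eccEnergy (coalescence f) < eccEnergy ((coalescence f).deleteEdges {e}) := by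
  have : Nonempty (Fin l) := ⟨⟨0, by omega⟩⟩
  have hW (i : Fin l) : Fintype.card {v : Fin (2 * n) // v ∉ Set.range (f i)} = n := by
    rw [Fintype.card_subtype_compl, Fintype.card_fin]
    have : Fintype.card {v // v ∈ Set.range (f i)} = n := by
      have := Set.card_range_of_injective (f i).injective
      rw [Fintype.card_fin] at this
      convert this
    omega
  rw [coalescence_top f] at he ⊢
  exact eccEnergy_cliqueBook_lt hn hl (Fintype.card_fin n) (Fintype.card_fin l) hW e he
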